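/- Let $R$ be an associative ring with identity and let $Q=(Q_0,Q_1)$ be a quiver, where an arrow $a$ has source $s(a)$ and target $t(a)$. Let $\mathrm{Rep}(Q,R)$ be the category of representations of $Q$ by left $R$-modules, that is, of functors from the path category of $Q$ to $R\text{-Mod}$. Definitions. - $Q$ is *locally target-finite* if every vertex is the source of only finitely many arrows. - $Q$ is *right rooted* if $W_\lambda=Q_0$ for some ordinal $\lambda$. Here $W_0=\emptyset$; $W_{\alpha+1}$ is the set of vertices that are not the source of any arrow $a$ with $t(a)\notin\bigcup_{\gamma\le\alpha}W_\gamma$; and $W_\alpha=\bigcup_{\beta<\alpha}W_\beta$ for limit ordinals $\alpha$. (Equivalently, $Q$ has no infinite sequence of arrows $\bullet\to\bullet\to\bullet\to\cdots$.) - For $S\in\mathrm{Rep}(Q^{\mathrm{op}},R^{\mathrm{op}})$ and $X\in\mathrm{Rep}(Q,R)$, the abelian group $S\otimes_Q X$ is the quotient of $\bigoplus_{i\in Q_0}S(i)\otimes_R X(i)$ by the relations $S(a^{\mathrm{op}})(s)\otimes x=s\otimes X(a)(x)$ for all arrows $a:i\to j$, $s\in S(j)$, $x\in X(i)$. (Equivalently,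 $-\otimes_Q X$ is the left adjoint of $G\mapsto \mathrm{Hom}_{\mathbb Z}(X,G)$.) - A representation $X$ is *strongly fp-injective* if it has a pure acyclic injective resolution. This is an exact sequence $0\to X\to E^0\to E^1\to\cdots$ in $\mathrm{Rep}(Q,R)$ with every $E^n$ injective that remains exact after applying $S\otimes_Q-$ for every $S\in\mathrm{Rep}(Q^{\mathrm{op}},R^{\mathrm{op}})$. - An $R$-module $M$ is *strongly fp-injective* if $\mathrm{Ext}^n_R(N,M)=0$ for every finitely presented $R$-module $N$ and every $n\ge 1$. - An epimorphism $g:M\to N$ of $R$-modules is *pure* if $0\to\ker g\to M\to N\to 0$ remains exact after applying $T\otimes_R-$ for every right $R$-module $T$. - For $X\in \mathrm{Rep}(Q,R)$ and $i\in Q_0$, the map $\psi_i^X: X(i)\to\prod_{a\in Q_1,\ s(a)=i}X(t(a))$ is the homomorphism whose $a$-th coordinate is $X(a)$. **Theorem.** Let $Q$ be a locally target-finite, right rooted quiver. A representation $X\in\mathrm{Rep}(Q,R)$ is strongly fp-injective if and only if the following two conditions hold for every vertex $i\in Q_0$: 1. $X(i)$ is a strongly fp-injective $R$-module; 2. $\psi_i^X: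 X(i)\to\prod_{a\in Q_1,\ s(a)=i}X(t(a))$ is a pure epimorphism. -/

import Mathlib

open CategoryTheory

universe u

namespace QuiverRep

/-! ### Quivers -/

section Quivers

variable (V : Type u) [Quiver.{u} V]

/-- `Q` is locally target-finite: every vertex is the source of only finitely many arrows
(`Quiver.Star v` is the set of all arrows with source `v`). -/
def LocallyTargetFinite : Prop := ∀ v : V, Finite (Quiver.Star v)

/-- The transfinite sequence `W_α` of sets of vertices: `W_0 = ∅`; a vertex is in `W_{β+1}` when
all arrows starting at it end in `⋃_{γ ≤ β} W_γ`; and `W_α = ⋃_{β < α} W_β` for a limit `α`.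
The three clauses are the lemmas `W_zero`, `W_add_one` and `W_limit` below. -/
def W (α : Ordinal.{u}) : Set V :=
  {i | (∃ (β : Ordinal.{u}) (_ : α = β + 1), ∀ (j : V) (_ : i ⟶ j),
          ∃ (γ : Ordinal.{u}) (_ : γ ≤ β), j ∈ W γ) ∨
       (Order.IsSuccLimit α ∧ ∃ (β : Ordinal.{u}) (_ : β < α), i ∈ W β)}
termination_by α
decreasing_by
  all_goals subst_vars
  · exact Order.lt_add_one_iff.2 ‹_›
  · assumption

theorem W_zero : W V 0 = ∅ := by
  rw [W]
  ext i
  constructor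
  · rintro (⟨β, h, -⟩ | ⟨h, -⟩)
    · exact absurd h.symm (by simp)
    · exact absurd isMin_bot h.1
  · exact fun h => h.elim

theorem W_add_one (β : Ordinal.{u}) :
    W V (β + 1) =
      {i | ¬ ∃ (j : V) (_ : i ⟶ j), j ∉ ⋃ (γ : Ordinal.{u}) (_ : γ ≤ β), W V γ} := by
  conv_lhs => rw [W]
  ext i
  simp only [Set.mem_ofPred_eq, Set.mem_iUnion]
  constructor
  · rintro (⟨β', h, h'⟩ | ⟨h, -⟩)
    · obtain rfl : β = β' := by simpa using h
      exact fun ⟨j, a, hj⟩ => hj (h' j a)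
    · exact absurd h (Order.not_isSuccLimit_add_one β)
  · exact fun h => Or.inl ⟨β, rfl, fun j a => by_contra fun hj => h ⟨j, a, hj⟩⟩

theorem W_limit (α : Ordinal.{u}) (hα : Order.IsSuccLimit α) :
    W V α = ⋃ (β : Ordinal.{u}) (_ : β < α), W V β := by
  conv_lhs => rw [W]
  ext i
  simp only [Set.mem_ofPred_eq, Set.mem_iUnion]
  constructor
  · rintro (⟨β', h, h'⟩ | ⟨-, h⟩)
    · exact absurd (h ▸ hα) (Order.not_isSuccLimit_add_one β')
    · exact h
  · exact fun h => Or.inr ⟨hα, h⟩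

/-- `Q` is right rooted: `W_α` is the set of all vertices for some ordinal `α`. -/
def RightRooted : Prop := ∃ α : Ordinal.{u}, W V α = Set.univ

end Quivers

/-! ### Modules over an associative ring -/

section Modules

variable {R : Type u} [Ring R]

/-- The relations imposed on formal sums of pairs `(m, n)` to obtain `M ⊗_R N`, for a right
`R`-module `M` and a left `R`-module `N`: biadditivity, and `(m r, n) = (m, r n)`. -/
inductive BalancedRel (M N : Type u) [AddCommGroup M] [Module Rᵐᵒᵖ M] [AddCommGroup N]
    [Module R N] : FreeAbelianGroup (M × N) → Prop
  | add_left (m m' : M) (n : N) : BalancedRel M N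
      (FreeAbelianGroup.of (m + m', n) - FreeAbelianGroup.of (m, n) - FreeAbelianGroup.of (m', n))
  | add_right (m : M) (n n' : N) : BalancedRel M N
      (FreeAbelianGroup.of (m, n + n') - FreeAbelianGroup.of (m, n) - FreeAbelianGroup.of (m, n'))
  | balanced (m : M) (r : R) (n : N) : BalancedRel M N
      (FreeAbelianGroup.of (MulOpposite.op r • m, n) - FreeAbelianGroup.of (m, r • n))

/-- The tensor product `M ⊗_R N` (an abelian group) of a right `R`-module `M`, that is, a module
over the opposite ring, and a left `R`-module `N`, for a not necessarily commutative ring `R`. -/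
def ModTensor (R M N : Type u) [Ring R] [AddCommGroup M] [Module Rᵐᵒᵖ M] [AddCommGroup N]
    [Module R N] : Type u :=
  FreeAbelianGroup (M × N) ⧸ AddSubgroup.closure {z | BalancedRel (R := R) M N z}

instance (M N : Type u) [AddCommGroup M] [Module Rᵐᵒᵖ M] [AddCommGroup N] [Module R N] :
    AddCommGroup (ModTensor R M N) :=
  inferInstanceAs (AddCommGroup (FreeAbelianGroup (M × N) ⧸ AddSubgroup.closure _))

/-- The map `M ⊗_R N → M ⊗_R N'`, `m ⊗ n ↦ m ⊗ f n`, induced by `f : N → N'`. -/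
def ModTensor.map (M : Type u) [AddCommGroup M] [Module Rᵐᵒᵖ M] {N N' : Type u}
    [AddCommGroup N] [Module R N] [AddCommGroup N'] [Module R N'] (f : N →ₗ[R] N') :
    ModTensor R M N →+ ModTensor R M N' :=
  QuotientAddGroup.map _ _ (FreeAbelianGroup.map fun p : M × N => (p.1, f p.2)) <| by
    rw [AddSubgroup.closure_le]
    rintro _ (⟨m, m', n⟩ | ⟨m, n, n'⟩ | ⟨m, r, n⟩) <;>
      refine AddSubgroup.subset_closure ?_ <;>
      simp only [map_sub, FreeAbelianGroup.map_of_apply, map_add, map_smul]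
    · exact .add_left m m' (f n)
    · exact .add_right m (f n) (f n')
    · exact .balanced m r (f n)

/-- `0 → L → M → N → 0` (with maps `f` and `g`) is a short exact sequence of abelian groups. -/
def IsShortExact {L M N : Type u} [AddCommGroup L] [AddCommGroup M] [AddCommGroup N]
    (f : L →+ M) (g : M →+ N) : Prop :=
  Function.Injective f ∧ Function.Exact f g ∧ Function.Surjective g

/-- A short exact sequence `0 → L → M → N → 0` of `R`-modules is pure if it remains exact after
applying `T ⊗_R -` for any right `R`-module `T`. -/
def IsPureShortExact {L M N : Type u} [AddCommGroup L] [Module R L] [AddCommGroup M] [Module R M]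
    [AddCommGroup N] [Module R N] (f : L →ₗ[R] M) (g : M →ₗ[R] N) : Prop :=
  IsShortExact f.toAddMonoidHom g.toAddMonoidHom ∧
    ∀ (T : Type u) [AddCommGroup T] [Module Rᵐᵒᵖ T],
      IsShortExact (ModTensor.map T f) (ModTensor.map T g)

/-- A homomorphism `g : M → N` of `R`-modules is a pure epimorphism if
`0 → ker g → M → N → 0` is a pure short exact sequence. -/
def IsPureEpi {M N : Type u} [AddCommGroup M] [Module R M] [AddCommGroup N] [Module R N]
    (g : M →ₗ[R] N) : Prop :=
  IsPureShortExact (LinearMap.ker g).subtype g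

/-- An `R`-module `M` is strongly fp-injective if `Ext^n_R(N, M) = 0` for every finitely presented
`R`-module `N` and every `n ≥ 1`. -/
def StronglyFpInjectiveModule (M : ModuleCat.{u} R) : Prop :=
  ∀ N : ModuleCat.{u} R, Module.FinitePresentation R N →
    ∀ n : ℕ, 1 ≤ n → Subsingleton (Abelian.Ext N M n)

end Modules

/-! ### Representations -/

section Representations

/-- `Rep(Q, R)`: functors from the path category of `Q` to left `R`-modules. -/
abbrev Rep (V : Type u) [Quiver.{u} V] (R : Type u) [Ring R] : Type (u + 1) :=
  Paths V ⥤ ModuleCat.{u} R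

variable {V : Type u} [Quiver.{u} V] {R : Type u} [Ring R]

/-- The module `X(i)` at a vertex `i`. -/
abbrev Rep.at (X : Rep V R) (i : V) : ModuleCat.{u} R := X.obj ((Paths.of V).obj i)

/-- The homomorphism `X(a) : X(i) → X(j)` of an arrow `a : i → j`. -/
abbrev Rep.arrow (X : Rep V R) {i j : V} (a : i ⟶ j) : X.at i →ₗ[R] X.at j :=
  (X.map ((Paths.of V).map a)).hom

/-- The component `f(i) : X(i) → Y(i)` at a vertex `i` of a morphism of representations. -/
abbrev Rep.homAt {X Y : Rep V R} (f : X ⟶ Y) (i : V) : X.at i →ₗ[R] Y.at i :=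
  (f.app ((Paths.of V).obj i)).hom

/-- The canonical map `ψ_i^X : X(i) → ∏ X(t(a))`, the product being over all arrows `a` with
source `i`, whose `a`-th coordinate is `X(a)`. -/
def Rep.psi (X : Rep V R) (i : V) :
    X.at i →ₗ[R] ((a : Quiver.Star i) → X.at a.1) :=
  LinearMap.pi fun a => X.arrow a.2

/-- The relations imposed on formal sums of pairs `(s, x)` in `S(i) × X(i)`, with `i` running over
all vertices, to obtain `S ⊗_Q X`: biadditivity and `(s r, x) = (s, r x)` at each vertex, and
`(S(aᵒᵖ) s, x) = (s, X(a) x)` for each arrow `a : i → j`, `s` in `S(j)` and `x` in `X(i)`. -/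
inductive TensorRel (S : Rep Vᵒᵖ Rᵐᵒᵖ) (X : Rep V R) :
    FreeAbelianGroup (Σ i : V, S.at (Opposite.op i) × X.at i) → Prop
  | add_left (i : V) (s s' : S.at (Opposite.op i)) (x : X.at i) : TensorRel S X
      (FreeAbelianGroup.of ⟨i, s + s', x⟩ - FreeAbelianGroup.of ⟨i, s, x⟩ -
        FreeAbelianGroup.of ⟨i, s', x⟩)
  | add_right (i : V) (s : S.at (Opposite.op i)) (x x' : X.at i) : TensorRel S X
      (FreeAbelianGroup.of ⟨i, s, x + x'⟩ - FreeAbelianGroup.of ⟨i, s, x⟩ -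
        FreeAbelianGroup.of ⟨i, s, x'⟩)
  | balanced (i : V) (s : S.at (Opposite.op i)) (r : R) (x : X.at i) : TensorRel S X
      (FreeAbelianGroup.of ⟨i, MulOpposite.op r • s, x⟩ - FreeAbelianGroup.of ⟨i, s, r • x⟩)
  | arrow {i j : V} (a : i ⟶ j) (s : S.at (Opposite.op j)) (x : X.at i) : TensorRel S X
      (FreeAbelianGroup.of ⟨i, S.arrow a.op s, x⟩ - FreeAbelianGroup.of ⟨j, s, X.arrow a x⟩)

/-- The tensor product `S ⊗_Q X` (an abelian group) of a representation `S` of the opposite quiver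
by right `R`-modules and a representation `X` of `Q` by left `R`-modules. Homomorphisms from it to
an abelian group `G` are the same as morphisms of representations from `S` to `Hom_ℤ(X, G)`, so
`- ⊗_Q X` is left adjoint to `Hom_ℤ(X, -)`. -/
def Tensor (S : Rep Vᵒᵖ Rᵐᵒᵖ) (X : Rep V R) : Type u :=
  FreeAbelianGroup (Σ i : V, S.at (Opposite.op i) × X.at i) ⧸
    AddSubgroup.closure {z | TensorRel S X z}

instance (S : Rep Vᵒᵖ Rᵐᵒᵖ) (X : Rep V R) : AddCommGroup (Tensor S X) :=
  inferInstanceAs (AddCommGroup (FreeAbelianGroup _ ⧸ AddSubgroup.closure _))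

theorem Rep.homAt_arrow {X Y : Rep V R} (f : X ⟶ Y) {i j : V} (a : i ⟶ j) (x : X.at i) :
    Rep.homAt f j (X.arrow a x) = Y.arrow a (Rep.homAt f i x) :=
  ConcreteCategory.congr_hom (f.naturality ((Paths.of V).map a)) x

/-- The map `S ⊗_Q X → S ⊗_Q Y`, `s ⊗ x ↦ s ⊗ f(i)(x)` for `s` in `S(i)` and `x` in `X(i)`,
induced by a morphism `f : X → Y` of representations. -/
def Tensor.map (S : Rep Vᵒᵖ Rᵐᵒᵖ) {X Y : Rep V R} (f : X ⟶ Y) : Tensor S X →+ Tensor S Y :=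
  QuotientAddGroup.map _ _
    (FreeAbelianGroup.map fun p : (Σ i : V, S.at (Opposite.op i) × X.at i) =>
      (⟨p.1, p.2.1, Rep.homAt f p.1 p.2.2⟩ : Σ i : V, S.at (Opposite.op i) × Y.at i)) <| by
    rw [AddSubgroup.closure_le]
    rintro _ (⟨i, s, s', x⟩ | ⟨i, s, x, x'⟩ | ⟨i, s, r, x⟩ | ⟨a, s, x⟩) <;>
      refine AddSubgroup.subset_closure ?_ <;>
      simp only [map_sub, FreeAbelianGroup.map_of_apply, map_add, map_smul, Rep.homAt_arrow]
    · exact .add_left i s s' _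
    · exact .add_right i s _ _
    · exact .balanced i s r _
    · exact .arrow a s _

/-- A representation `X` is strongly fp-injective if it has a pure acyclic injective resolution:
a sequence `0 → X → E⁰ → E¹ → ⋯` of representations with every `Eⁿ` injective in `Rep(Q, R)`
which is exact (that is, exact at every vertex) and which remains exact after applying `S ⊗_Q -`
for any representation `S` of the opposite quiver over the opposite ring. -/
def StronglyFpInjective (X : Rep V R) : Prop :=
  ∃ (E : ℕ → Rep V R) (ε : X ⟶ E 0) (d : ∀ n, E n ⟶ E (n + 1)),
    (∀ n, Injective (E n)) ∧
    (∀ i : V,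
      Function.Injective (Rep.homAt ε i) ∧
      Function.Exact (Rep.homAt ε i) (Rep.homAt (d 0) i) ∧
      ∀ n, Function.Exact (Rep.homAt (d n) i) (Rep.homAt (d (n + 1)) i)) ∧
    ∀ S : Rep Vᵒᵖ Rᵐᵒᵖ,
      Function.Injective (Tensor.map S ε) ∧
      Function.Exact (Tensor.map S ε) (Tensor.map S (d 0)) ∧
      ∀ n, Function.Exact (Tensor.map S (d n)) (Tensor.map S (d (n + 1)))

end Representations

end QuiverRep

/-! The proof replaces purity by a statement about equations. For a monomorphism `ε : X ⟶ E`,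
injectivity of `S ⊗ ε` for all `S` is equivalent to `SystemsSolvable ε`: a finite linear system with
constants in `X` that has a solution in `E` has one in `X`. To get solvability, test against the
character dual of `X` (`SystemsSolvable.of_tensor_injective`). Conversely, a proof that a tensor
vanishes uses only finitely many identities in `E`, and these can be solved again in `X`
(`SystemsSolvable.tensor_injective`). A module is a representation of the quiver with one point, so
the same theory shows that a pure epimorphism of modules is one along which maps from finitely
presented modules lift (`isPureEpi_iff`).

Let `0 → X → E → Y → 0` be exact with `E` injective. Every `ψ` of `E` is split, because `E` is a
retract of a coinduced representation. If `ε` is pure, solving systems lifts a map `P → Y(i)` with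
`P` finitely presented to `E(i)`, and a map killed by finitely many arrows lifts to one killed by
the same arrows. This gives lifting along `ψ` of `X` (`SystemsSolvable.fpLifting_psi`); here local
target-finiteness keeps the system finite. Dimension shifting along a pure acyclic resolution kills
the higher `Ext` groups at each vertex.

For the converse, rootedness and local target-finiteness leave finitely many paths between two
vertices, so a finitely presented representation is finitely presented at each vertex. A map from it
to `Y` lifts to `E` by well-founded recursion along the arrows: lift at a vertex, then use `ψ` of
`X` to correct the failure to commute with the outgoing arrows (`SystemsSolvable.of_vertexwise`).
Hence `ε` is pure. The vertex conditions pass from `X` to `Y`, so the step can be iterated and the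
sequences spliced into a pure acyclic resolution. -/

namespace QuiverRep

/-! ### Ext vanishing and lifting from finitely presented modules -/

section Modules

variable {R : Type u} [Ring R]

/-- A short exact sequence of modules, as a short exact sequence in the module category. -/
theorem shortExact_ofHom {L M N : Type u} [AddCommGroup L] [Module R L] [AddCommGroup M]
    [Module R M] [AddCommGroup N] [Module R N] {f : L →ₗ[R] M} {g : M →ₗ[R] N}
    (hf : Function.Injective f) (hfg : Function.Exact f g) (hg : Function.Surjective g) :
    (ShortComplex.mk (ModuleCat.ofHom f) (ModuleCat.ofHom g)
      (by rw [← ModuleCat.ofHom_comp, hfg.linearMap_comp_eq_zero]; rfl)).ShortExact where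
  exact := by
    rw [ShortComplex.ShortExact.moduleCat_exact_iff_function_exact]
    exact hfg
  mono_f := (ModuleCat.mono_iff_injective _).2 hf
  epi_g := (ModuleCat.epi_iff_surjective _).2 hg

/-- Linear maps from finitely presented modules lift along `g`. -/
def FpLifting {M N : Type u} [AddCommGroup M] [Module R M] [AddCommGroup N] [Module R N]
    (g : M →ₗ[R] N) : Prop :=
  ∀ (P : Type u) [AddCommGroup P] [Module R P], Module.FinitePresentation R P →
    ∀ f : P →ₗ[R] N, ∃ h : P →ₗ[R] M, g ∘ₗ h = f

theorem FpLifting.surjective {M N : Type u} [AddCommGroup M] [Module R M] [AddCommGroup N]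
    [Module R N] {g : M →ₗ[R] N} (hg : FpLifting g) : Function.Surjective g := fun y => by
  obtain ⟨h, hh⟩ := hg R inferInstance (LinearMap.toSpanSingleton R N y)
  exact ⟨h 1, by simpa using LinearMap.congr_fun hh 1⟩

section ShortExact

variable {L M N : Type u} [AddCommGroup L] [Module R L] [AddCommGroup M] [Module R M]
  [AddCommGroup N] [Module R N] {f : L →ₗ[R] M} {g : M →ₗ[R] N}

/-- The obstruction to lifting a map `P → N` is its image under the connecting map to `Ext¹(P, L)`,
which vanishes. -/
theorem StronglyFpInjectiveModule.fpLifting (hL : StronglyFpInjectiveModule (ModuleCat.of R L))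
    (hf : Function.Injective f) (hfg : Function.Exact f g) (hg : Function.Surjective g) :
    FpLifting g := by
  intro P _ _ hP k
  have hs := shortExact_ofHom hf hfg hg
  have := hL (ModuleCat.of R P) hP 1 le_rfl
  obtain ⟨x, hx⟩ := Abelian.Ext.covariant_sequence_exact₃ (ModuleCat.of R P) hs
    (Abelian.Ext.mk₀ (ModuleCat.ofHom k)) (zero_add 1) (Subsingleton.elim _ _)
  obtain ⟨h, rfl⟩ := (Abelian.Ext.mk₀_bijective _ _).2 x
  rw [Abelian.Ext.mk₀_comp_mk₀] at hx
  refine ⟨h.hom, ?_⟩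
  have := (Abelian.Ext.mk₀_bijective _ _).1 hx
  exact congrArg ModuleCat.Hom.hom this

/-- In the long exact sequence `Extⁿ(P, N)` sits between `Extⁿ(P, M)` and `Extⁿ⁺¹(P, L)`, both zero.
-/
theorem StronglyFpInjectiveModule.of_left_middle
    (hL : StronglyFpInjectiveModule (ModuleCat.of R L))
    (hM : StronglyFpInjectiveModule (ModuleCat.of R M))
    (hf : Function.Injective f) (hfg : Function.Exact f g) (hg : Function.Surjective g) :
    StronglyFpInjectiveModule (ModuleCat.of R N) := by
  intro P hP n hn
  have hs := shortExact_ofHom hf hfg hg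
  refine subsingleton_of_forall_eq 0 fun x => ?_
  have := hL P hP (n + 1) (by omega)
  obtain ⟨y, rfl⟩ := Abelian.Ext.covariant_sequence_exact₃ P hs x rfl (Subsingleton.elim _ _)
  have := hM P hP n hn
  rw [Subsingleton.elim y 0, Abelian.Ext.zero_comp]

/-- Dimension shifting: every class in `Extⁿ⁺¹(P, L)` comes from `Extⁿ(P, N)` by the connecting map.
For `n = 0` the source is `Hom(P, N)`, which need not vanish; the connecting map is zero there
because every map lifts along `g`. -/
theorem subsingleton_ext_succ_left (P : ModuleCat.{u} R) (n : ℕ)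
    (hM : Subsingleton (Abelian.Ext P (ModuleCat.of R M) (n + 1)))
    (hN : 1 ≤ n → Subsingleton (Abelian.Ext P (ModuleCat.of R N) n))
    (hP : Module.FinitePresentation R P)
    (hf : Function.Injective f) (hfg : Function.Exact f g) (hg : FpLifting g) :
    Subsingleton (Abelian.Ext P (ModuleCat.of R L) (n + 1)) := by
  have hs := shortExact_ofHom hf hfg hg.surjective
  refine subsingleton_of_forall_eq 0 fun x => ?_
  obtain ⟨y, rfl⟩ := Abelian.Ext.covariant_sequence_exact₁ P hs x
    (Subsingleton.elim (α := Abelian.Ext P (ModuleCat.of R M) (n + 1)) _ _) rfl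
  obtain rfl | hn := Nat.eq_zero_or_pos n
  · obtain ⟨k, rfl⟩ := (Abelian.Ext.mk₀_bijective _ _).2 y
    obtain ⟨h, hh⟩ := hg P hP k.hom
    have : k = ModuleCat.ofHom h ≫ ModuleCat.ofHom g := by
      ext x
      exact (LinearMap.congr_fun hh x).symm
    rw [this, ← Abelian.Ext.mk₀_comp_mk₀, Abelian.Ext.comp_assoc_of_second_deg_zero]
    have := hs.comp_extClass
    dsimp only at this
    rw [this, Abelian.Ext.comp_zero]
  · have := hN hn
    have hy : y = 0 := Subsingleton.elim (α := Abelian.Ext P (ModuleCat.of R N) n) _ _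
    rw [hy, Abelian.Ext.zero_comp]

end ShortExact

theorem StronglyFpInjectiveModule.of_injective (M : ModuleCat.{u} R) [Injective M] :
    StronglyFpInjectiveModule M := fun P _ n hn => by
  obtain ⟨n, rfl⟩ : ∃ m, n = m + 1 := ⟨n - 1, by omega⟩
  exact Abelian.Ext.subsingleton_of_injective P M n

end Modules

/-! ### Tensor products over a quiver and their right exactness -/

section Tensor

variable {V : Type u} [Quiver.{u} V] {R : Type u} [Ring R]

/-- The class of `s ⊗ x` in `S ⊗_Q X`. -/
def Tensor.mk (S : Rep Vᵒᵖ Rᵐᵒᵖ) (X : Rep V R) (i : V) (s : S.at (Opposite.op i)) (x : X.at i) :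
    Tensor S X :=
  QuotientAddGroup.mk (FreeAbelianGroup.of ⟨i, s, x⟩)

section

variable (S : Rep Vᵒᵖ Rᵐᵒᵖ) (X : Rep V R)

theorem Tensor.mk_eq_zero_of_rel {z : FreeAbelianGroup (Σ i : V, S.at (Opposite.op i) × X.at i)}
    (hz : TensorRel S X z) : (QuotientAddGroup.mk z : Tensor S X) = 0 :=
  (QuotientAddGroup.eq_zero_iff z).2 (AddSubgroup.subset_closure hz)

theorem Tensor.add_mk (i : V) (s s' : S.at (Opposite.op i)) (x : X.at i) :
    Tensor.mk S X i (s + s') x = Tensor.mk S X i s x + Tensor.mk S X i s' x := by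
  have := Tensor.mk_eq_zero_of_rel S X (.add_left i s s' x)
  exact eq_add_of_sub_eq' (sub_eq_zero.1 this)

theorem Tensor.mk_add (i : V) (s : S.at (Opposite.op i)) (x x' : X.at i) :
    Tensor.mk S X i s (x + x') = Tensor.mk S X i s x + Tensor.mk S X i s x' := by
  have := Tensor.mk_eq_zero_of_rel S X (.add_right i s x x')
  exact eq_add_of_sub_eq' (sub_eq_zero.1 this)

theorem Tensor.op_smul_mk (i : V) (s : S.at (Opposite.op i)) (r : R) (x : X.at i) :
    Tensor.mk S X i (MulOpposite.op r • s) x = Tensor.mk S X i s (r • x) :=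
  sub_eq_zero.1 (Tensor.mk_eq_zero_of_rel S X (.balanced i s r x))

theorem Tensor.arrow_mk {i j : V} (a : i ⟶ j) (s : S.at (Opposite.op j)) (x : X.at i) :
    Tensor.mk S X i (S.arrow a.op s) x = Tensor.mk S X j s (X.arrow a x) :=
  sub_eq_zero.1 (Tensor.mk_eq_zero_of_rel S X (.arrow a s x))

/-- The homomorphism `x ↦ s ⊗ x`. -/
def Tensor.mkLeft (i : V) (s : S.at (Opposite.op i)) : X.at i →+ Tensor S X :=
  AddMonoidHom.mk' (Tensor.mk S X i s) (Tensor.mk_add S X i s)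

/-- The homomorphism `s ↦ s ⊗ x`. -/
def Tensor.mkRight (i : V) (x : X.at i) : S.at (Opposite.op i) →+ Tensor S X :=
  AddMonoidHom.mk' (fun s => Tensor.mk S X i s x) fun s s' => Tensor.add_mk S X i s s' x

variable {S X}

theorem Tensor.addHom_ext {A : Type*} [AddCommGroup A] {f g : Tensor S X →+ A}
    (h : ∀ i s x, f (Tensor.mk S X i s x) = g (Tensor.mk S X i s x)) : f = g :=
  QuotientAddGroup.addMonoidHom_ext _ (FreeAbelianGroup.lift_ext _ _ fun ⟨i, s, x⟩ => h i s x)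

/-- The homomorphism from `S ⊗_Q X` given by a balanced family of functions. -/
def Tensor.lift {A : Type*} [AddCommGroup A] (f : ∀ i, S.at (Opposite.op i) → X.at i → A)
    (h₁ : ∀ i s s' x, f i (s + s') x = f i s x + f i s' x)
    (h₂ : ∀ i s x x', f i s (x + x') = f i s x + f i s x')
    (h₃ : ∀ i s (r : R) x, f i (MulOpposite.op r • s) x = f i s (r • x))
    (h₄ : ∀ {i j : V} (a : i ⟶ j) (s : S.at (Opposite.op j)) (x : X.at i),
      f i (S.arrow a.op s) x = f j s (X.arrow a x)) : Tensor S X →+ A :=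
  QuotientAddGroup.lift _ (FreeAbelianGroup.lift fun p => f p.1 p.2.1 p.2.2) <| by
    rw [AddSubgroup.closure_le]
    rintro _ (⟨i, s, s', x⟩ | ⟨i, s, x, x'⟩ | ⟨i, s, r, x⟩ | ⟨a, s, x⟩) <;>
      simp only [SetLike.mem_coe, AddMonoidHom.mem_ker, map_sub, FreeAbelianGroup.lift_apply_of]
    · rw [h₁]; abel
    · rw [h₂]; abel
    · rw [h₃, sub_self]
    · rw [h₄, sub_self]

@[simp]
theorem Tensor.lift_mk {A : Type*} [AddCommGroup A] (f : ∀ i, S.at (Opposite.op i) → X.at i → A)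
    (h₁ h₂ h₃) (h₄ : ∀ {i j : V} (a : i ⟶ j) (s : S.at (Opposite.op j)) (x : X.at i),
      f i (S.arrow a.op s) x = f j s (X.arrow a x)) (i : V) (s : S.at (Opposite.op i)) (x : X.at i) :
    Tensor.lift f h₁ h₂ h₃ h₄ (Tensor.mk S X i s x) = f i s x :=
  FreeAbelianGroup.lift_apply_of _ _

@[simp]
theorem Tensor.map_mk {Y : Rep V R} (f : X ⟶ Y) (i : V) (s : S.at (Opposite.op i)) (x : X.at i) :
    Tensor.map S f (Tensor.mk S X i s x) = Tensor.mk S Y i s (Rep.homAt f i x) := by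
  refine congrArg QuotientAddGroup.mk ?_
  exact FreeAbelianGroup.map_of_apply _

theorem Tensor.map_comp {Y Z : Rep V R} (f : X ⟶ Y) (g : Y ⟶ Z) :
    Tensor.map S (f ≫ g) = (Tensor.map S g).comp (Tensor.map S f) :=
  Tensor.addHom_ext fun i s x => by simp; rfl

end

/-- A short exact sequence `0 → X → E → Y → 0` of representations. -/
structure IsShortExactRep {X E Y : Rep V R} (ε : X ⟶ E) (π : E ⟶ Y) : Prop where
  injective : ∀ i, Function.Injective (Rep.homAt ε i)
  exact : ∀ i, Function.Exact (Rep.homAt ε i) (Rep.homAt π i)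
  surjective : ∀ i, Function.Surjective (Rep.homAt π i)

variable {X E Y : Rep V R} {ε : X ⟶ E} {π : E ⟶ Y}

theorem IsShortExactRep.tensor_surjective (h : IsShortExactRep ε π) (S : Rep Vᵒᵖ Rᵐᵒᵖ) :
    Function.Surjective (Tensor.map S π) := by
  rw [← AddMonoidHom.range_eq_top, ← top_le_iff]
  rintro z -
  obtain ⟨z, rfl⟩ := QuotientAddGroup.mk_surjective z
  induction z using FreeAbelianGroup.induction_on with
  | zero => exact zero_mem _
  | of p =>
    obtain ⟨i, s, y⟩ := p
    obtain ⟨e, rfl⟩ := h.surjective i y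
    exact ⟨Tensor.mk S E i s e, Tensor.map_mk _ _ _ _⟩
  | neg p hp => exact neg_mem hp
  | add a b ha hb => exact add_mem ha hb

/-- Two preimages in `E` of an element of `Y` differ by an element of `X`, so `s ⊗ y ↦ s ⊗ e`, with
`e` any preimage of `y`, is well defined modulo the image of `S ⊗ X`. -/
theorem IsShortExactRep.tensor_exact (h : IsShortExactRep ε π) (S : Rep Vᵒᵖ Rᵐᵒᵖ) :
    Function.Exact (Tensor.map S ε) (Tensor.map S π) := by
  have hzero : ∀ i x, Rep.homAt π i (Rep.homAt ε i x) = 0 := fun i x =>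
    (h.exact i).apply_apply_eq_zero x
  have key : ∀ i s {e e' : E.at i}, Rep.homAt π i e = Rep.homAt π i e' →
      (QuotientAddGroup.mk (Tensor.mk S E i s e) : Tensor S E ⧸ (Tensor.map S ε).range) =
        QuotientAddGroup.mk (Tensor.mk S E i s e') := by
    intro i s e e' he
    obtain ⟨x, hx⟩ := (h.exact i (e' - e)).1 (by rw [map_sub, he, sub_self])
    rw [QuotientAddGroup.eq]
    refine ⟨Tensor.mk S X i s x, ?_⟩
    rw [Tensor.map_mk, hx]
    refine (map_sub (Tensor.mkLeft S E i s) e' e).trans ?_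
    rw [neg_add_eq_sub]
    rfl
  have hsec : ∀ i (y : Y.at i), Rep.homAt π i (Function.surjInv (h.surjective i) y) = y := fun i y =>
    Function.surjInv_eq (h.surjective i) y
  -- Composing `φ` with `S ⊗ π` gives the quotient map, so the kernel of `S ⊗ π` lies in the range
  -- of `S ⊗ ε`.
  let φ : Tensor S Y →+ Tensor S E ⧸ (Tensor.map S ε).range :=
    Tensor.lift (fun i s y => QuotientAddGroup.mk
        (Tensor.mk S E i s (Function.surjInv (h.surjective i) y)))
      (fun i s s' y => by rw [Tensor.add_mk]; rfl)
      (fun i s y y' => by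
        rw [← QuotientAddGroup.mk_add, ← Tensor.mk_add]
        refine key i s ?_
        rw [map_add, hsec, hsec, hsec])
      (fun i s r y => by
        rw [Tensor.op_smul_mk]
        refine key i s ?_
        rw [map_smul, hsec, hsec])
      (fun {i j} a s y => by
        rw [Tensor.arrow_mk]
        refine key j s ?_
        rw [Rep.homAt_arrow, hsec, hsec])
  have hφ : φ.comp (Tensor.map S π) = QuotientAddGroup.mk' _ := Tensor.addHom_ext fun i s e => by
    rw [AddMonoidHom.comp_apply, Tensor.map_mk]
    refine (Tensor.lift_mk _ _ _ _ _ _ _ _).trans (key i s ?_)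
    rw [hsec]
  intro z
  constructor
  · intro hz
    have := DFunLike.congr_fun hφ z
    rw [AddMonoidHom.comp_apply, hz, map_zero] at this
    exact (QuotientAddGroup.eq_zero_iff z).1 this.symm
  · rintro ⟨w, rfl⟩
    have : (Tensor.map S π).comp (Tensor.map S ε) = 0 := Tensor.addHom_ext fun i s x => by
      rw [AddMonoidHom.comp_apply, Tensor.map_mk, Tensor.map_mk, hzero]
      exact map_zero (Tensor.mkLeft S Y i s)
    exact DFunLike.congr_fun this w

end Tensor

/-! ### Modules as representations of the quiver with one vertex and no arrows -/

section OneVertex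

variable {R : Type u} [Ring R]

/-- The quiver with one vertex and no arrows. -/
abbrev Point : Type u := Quiver.Empty PUnit.{u + 1}

/-- The vertex of `Point`. -/
abbrev pt : Point.{u} := PUnit.unit

/-- A module as a representation of the quiver with one vertex and no arrows. -/
abbrev constRep (M : Type u) [AddCommGroup M] [Module R M] : Rep Point.{u} R :=
  (Functor.const _).obj (ModuleCat.of R M)

/-- A linear map as a morphism of representations. -/
abbrev constHom {M N : Type u} [AddCommGroup M] [Module R M] [AddCommGroup N] [Module R N]
    (f : M →ₗ[R] N) : constRep M ⟶ constRep (R := R) N :=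
  (Functor.const _).map (ModuleCat.ofHom f)

/-- `S ⊗ M` for a module `M`, as a tensor product over the quiver with one vertex. -/
def constTensorEquiv (S : Rep Point.{u}ᵒᵖ Rᵐᵒᵖ) (M : Type u) [AddCommGroup M] [Module R M] :
    Tensor S (constRep (R := R) M) ≃+ ModTensor R (S.at (Opposite.op pt)) M where
  __ := QuotientAddGroup.map _ _ (FreeAbelianGroup.map fun p => (p.2.1, p.2.2)) (by
    rw [AddSubgroup.closure_le]
    rintro _ (⟨i, s, s', x⟩ | ⟨i, s, x, x'⟩ | ⟨i, s, r, x⟩ | ⟨⟨⟩, s, x⟩) <;>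
      refine AddSubgroup.subset_closure ?_ <;>
      simp only [map_sub, FreeAbelianGroup.map_of_apply]
    · exact .add_left _ _ _
    · exact .add_right _ _ _
    · exact .balanced _ _ _)
  invFun := QuotientAddGroup.map _ _ (FreeAbelianGroup.map fun p => ⟨pt, p.1, p.2⟩) (by
    rw [AddSubgroup.closure_le]
    rintro _ (⟨s, s', x⟩ | ⟨s, x, x'⟩ | ⟨s, r, x⟩) <;>
      refine AddSubgroup.subset_closure ?_ <;>
      simp only [map_sub, FreeAbelianGroup.map_of_apply]
    · exact .add_left _ _ _ _
    · exact .add_right _ _ _ _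
    · exact .balanced _ _ _ _)
  left_inv z := by
    obtain ⟨z, rfl⟩ := QuotientAddGroup.mk_surjective z
    refine congrArg QuotientAddGroup.mk ?_
    rw [← FreeAbelianGroup.map_comp_apply]
    exact FreeAbelianGroup.map_id_apply z
  right_inv z := by
    obtain ⟨z, rfl⟩ := QuotientAddGroup.mk_surjective z
    refine congrArg QuotientAddGroup.mk ?_
    rw [← FreeAbelianGroup.map_comp_apply]
    exact FreeAbelianGroup.map_id_apply z

theorem constTensorEquiv_map (S : Rep Point.{u}ᵒᵖ Rᵐᵒᵖ) {M N : Type u} [AddCommGroup M]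
    [Module R M] [AddCommGroup N] [Module R N] (f : M →ₗ[R] N)
    (z : Tensor S (constRep (R := R) M)) :
    constTensorEquiv S N (Tensor.map S (constHom f) z) =
      ModTensor.map (S.at (Opposite.op pt)) f (constTensorEquiv S M z) := by
  obtain ⟨z, rfl⟩ := QuotientAddGroup.mk_surjective z
  refine congrArg QuotientAddGroup.mk ?_
  rw [← FreeAbelianGroup.map_comp_apply, ← FreeAbelianGroup.map_comp_apply]
  rfl

variable {L M N : Type u} [AddCommGroup L] [Module R L] [AddCommGroup M] [Module R M]
    [AddCommGroup N] [Module R N] {f : L →ₗ[R] M} {g : M →ₗ[R] N}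

theorem isShortExactRep_constHom
    (h : IsShortExact f.toAddMonoidHom g.toAddMonoidHom) :
    IsShortExactRep (constHom f) (constHom g) where
  injective _ := h.1
  exact _ := h.2.1
  surjective _ := h.2.2

/-- Right exactness of the tensor product is automatic, so only injectivity on the left is a
condition. -/
theorem isPureShortExact_iff :
    IsPureShortExact f g ↔ IsShortExact f.toAddMonoidHom g.toAddMonoidHom ∧
      ∀ S : Rep Point.{u}ᵒᵖ Rᵐᵒᵖ, Function.Injective (Tensor.map S (constHom f)) := by
  refine and_congr_right fun h => ⟨fun H S => ?_, fun H T _ _ => ?_⟩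
  · have h1 := ((H (S.at (Opposite.op pt))).1.comp (constTensorEquiv S L).injective)
    refine Function.Injective.of_comp (f := constTensorEquiv S M) ?_
    convert h1 using 1
    exact funext fun z => constTensorEquiv_map S f z
  · let S : Rep Point.{u}ᵒᵖ Rᵐᵒᵖ := (Functor.const _).obj (ModuleCat.of Rᵐᵒᵖ T)
    have hs := isShortExactRep_constHom h
    have key : ∀ {A B : Type u} [AddCommGroup A] [AddCommGroup B] [Module R A] [Module R B]
        (k : A →ₗ[R] B) (z : ModTensor R T A), ModTensor.map T k z =
          constTensorEquiv S B (Tensor.map S (constHom k) ((constTensorEquiv S A).symm z)) := by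
      intro A B _ _ _ _ k z
      rw [constTensorEquiv_map, AddEquiv.apply_symm_apply]
      rfl
    refine ⟨fun z w hzw => ?_, fun z => ?_, fun z => ?_⟩
    · rw [key, key] at hzw
      exact (constTensorEquiv S L).symm.injective (H S ((constTensorEquiv S M).injective hzw))
    · rw [key, ← map_zero (constTensorEquiv S N), (constTensorEquiv S N).injective.eq_iff,
        hs.tensor_exact S]
      constructor
      · rintro ⟨w, hw⟩
        refine ⟨constTensorEquiv S L w, ?_⟩
        rw [key, AddEquiv.symm_apply_apply, hw, AddEquiv.apply_symm_apply]
      · rintro ⟨w, rfl⟩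
        refine ⟨(constTensorEquiv S L).symm w, ?_⟩
        rw [key, AddEquiv.symm_apply_apply]
    · obtain ⟨w, hw⟩ := hs.tensor_surjective S ((constTensorEquiv S N).symm z)
      refine ⟨constTensorEquiv S M w, ?_⟩
      rw [key, AddEquiv.symm_apply_apply, hw, AddEquiv.apply_symm_apply]

end OneVertex

/-! ### Coinduced functors and enough injectives -/

section Coinduced

variable {R : Type u} [Ring R] {C : Type u} [SmallCategory C]

/-- The product of the modules `M d` over all morphisms `c ⟶ d`. -/
abbrev CoinducedObj (M : C → ModuleCat.{u} R) (c : C) : Type u := ∀ p : (Σ d, (c ⟶ d)), M p.1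

/-- The functor `c ↦ ∏_{c ⟶ d} M d` coinduced from a family of modules. -/
def coinduced (M : C → ModuleCat.{u} R) : C ⥤ ModuleCat.{u} R where
  obj c := ModuleCat.of R (CoinducedObj M c)
  map {c c'} q := ModuleCat.ofHom (Y := CoinducedObj M c') (LinearMap.pi fun p =>
    LinearMap.proj (φ := fun p : (Σ d, (c ⟶ d)) => M p.1) ⟨p.1, q ≫ p.2⟩)
  map_id c := by
    refine ModuleCat.hom_ext (LinearMap.ext fun (f : CoinducedObj M c) =>
      funext fun p => ?_)
    exact congrArg (β := M p.1) (fun q => (f ⟨p.1, q⟩ : M p.1)) (Category.id_comp p.2)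
  map_comp {c _ _} q q' := by
    refine ModuleCat.hom_ext (LinearMap.ext fun (f : CoinducedObj M c) =>
      funext fun p => ?_)
    exact congrArg (β := M p.1) (fun q => (f ⟨p.1, q⟩ : M p.1)) (Category.assoc q q' p.2)

/-- The morphism to a coinduced functor given by a family of linear maps. -/
def coinducedLift {M : C → ModuleCat.{u} R} (Y : C ⥤ ModuleCat.{u} R)
    (φ : ∀ d, Y.obj d ⟶ M d) : Y ⟶ coinduced M where
  app c := ModuleCat.ofHom (Y := CoinducedObj M c) (LinearMap.pi fun p => (Y.map p.2 ≫ φ p.1).hom)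
  naturality c c' q := by
    refine ModuleCat.hom_ext (LinearMap.ext fun y =>
      funext (f := (_ : CoinducedObj M c')) fun p => ?_)
    change (Y.map p.2 ≫ φ p.1).hom ((Y.map q).hom y) = (Y.map (q ≫ p.2) ≫ φ p.1).hom y
    rw [Y.map_comp]
    rfl

/-- A morphism into a coinduced functor amounts to an arbitrary family of linear maps into the `M
d`, with no naturality required, so it can be extended one object at a time. -/
theorem injective_coinduced (M : C → ModuleCat.{u} R) [∀ d, Injective (M d)] :
    Injective (coinduced M) where
  factors {A B} g f hf := by
    have : ∀ d, Mono (f.app d) := fun d => inferInstance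
    let ev : ∀ d, A.obj d ⟶ M d := fun d => g.app d ≫ ModuleCat.ofHom (X := CoinducedObj M d)
      (LinearMap.proj (φ := fun p : (Σ d', (d ⟶ d')) => M p.1) ⟨d, 𝟙 d⟩)
    refine ⟨coinducedLift B fun d => Injective.factorThru (ev d) (f.app d), ?_⟩
    ext c : 2
    refine ModuleCat.hom_ext (LinearMap.ext fun x =>
      funext (f := (_ : CoinducedObj M c)) fun p => ?_)
    change (B.map p.2 ≫ Injective.factorThru (ev p.1) (f.app p.1)).hom ((f.app c).hom x) = _
    have h1 : f.app c ≫ B.map p.2 ≫ Injective.factorThru (ev p.1) (f.app p.1) =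
        A.map p.2 ≫ ev p.1 := by
      rw [← NatTrans.naturality_assoc, Injective.comp_factorThru]
    refine (ConcreteCategory.congr_hom h1 x).trans ?_
    change ((g.app p.1).hom ((A.map p.2).hom x) : CoinducedObj M p.1) ⟨p.1, 𝟙 _⟩ =
      ((g.app c).hom x : CoinducedObj M c) p
    have h2 := ConcreteCategory.congr_hom (g.naturality p.2) x
    refine (congrFun (f := (_ : CoinducedObj M p.1)) h2 ⟨p.1, 𝟙 _⟩).trans ?_
    exact congrArg (β := M p.1) (fun q => (((g.app c).hom x : CoinducedObj M c) ⟨p.1, q⟩ : M p.1))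
      (Category.comp_id p.2)

theorem injective_coinduced_obj (M : C → ModuleCat.{u} R) [h : ∀ d, Injective (M d)] (c : C) :
    Injective ((coinduced M).obj c) := by
  have : ∀ p : (Σ d, (c ⟶ d)), Module.Injective R (M p.1) := fun p =>
    (Module.injective_iff_injective_object R _).2 (h p.1)
  exact (Module.injective_iff_injective_object R (CoinducedObj M c)).1
    (inferInstanceAs (Module.Injective R (∀ p : (Σ d, (c ⟶ d)), M p.1)))

/-- The coinduced functor on injective hulls of the values of `X`. -/
noncomputable abbrev injectiveHull (X : C ⥤ ModuleCat.{u} R) : C ⥤ ModuleCat.{u} R :=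
  coinduced fun d => Injective.under (X.obj d)

/-- The embedding of `X` into an injective functor. -/
noncomputable def injectiveHullι (X : C ⥤ ModuleCat.{u} R) : X ⟶ injectiveHull X :=
  coinducedLift X fun d => Injective.ι (X.obj d)

theorem injectiveHullι_app_injective (X : C ⥤ ModuleCat.{u} R) (c : C) :
    Function.Injective ((injectiveHullι X).app c).hom := by
  intro x y hxy
  have h := congrArg
    (fun f : CoinducedObj (fun d => Injective.under (X.obj d)) c => f ⟨c, 𝟙 c⟩) hxy
  change (X.map (𝟙 c) ≫ Injective.ι (X.obj c)).hom x =
    (X.map (𝟙 c) ≫ Injective.ι (X.obj c)).hom y at h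
  rw [X.map_id, Category.id_comp] at h
  exact (ModuleCat.mono_iff_injective (Injective.ι (X.obj c))).1 inferInstance h

instance (X : C ⥤ ModuleCat.{u} R) : Mono (injectiveHullι X) := by
  rw [NatTrans.mono_iff_mono_app]
  exact fun c => (ModuleCat.mono_iff_injective _).2 (injectiveHullι_app_injective X c)

/-- An injective functor is a retract of a coinduced one, whose values are products of injective
modules. -/
theorem injective_obj_of_injective (X : C ⥤ ModuleCat.{u} R) [Injective X] (c : C) :
    Injective (X.obj c) := by
  have hr := Injective.comp_factorThru (𝟙 X) (injectiveHullι X)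
  have := injective_coinduced_obj (fun d => Injective.under (X.obj d)) c
  refine Retract.injective (Y := (injectiveHull X).obj c)
    ⟨(injectiveHullι X).app c, (Injective.factorThru (𝟙 X) (injectiveHullι X)).app c, ?_⟩
  rw [← NatTrans.comp_app, hr, NatTrans.id_app]

end Coinduced

/-! ### Splitting off the first arrow of a path -/

section FirstArrow

variable {V : Type u} [Quiver.{u} V]

/-- The decomposition of a path of positive length into its first arrow and the rest. -/
def firstArrow {i : V} : ∀ {j : V}, Quiver.Path i j →
    Option (Σ a : Quiver.Star i, Quiver.Path a.1 j)
  | _, .nil => none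
  | _, .cons .nil a => some ⟨⟨_, a⟩, .nil⟩
  | _, .cons (.cons p b) a => (firstArrow (.cons p b)).map fun x => ⟨x.1, x.2.cons a⟩

/-- Paths are built by appending arrows at the target end, so the induction is on the remaining path
`p`. -/
theorem firstArrow_toPath_comp {i j k : V} (a : i ⟶ j) (p : Quiver.Path j k) :
    firstArrow (a.toPath.comp p) = some ⟨⟨j, a⟩, p⟩ := by
  induction p with
  | nil => rfl
  | cons p b ih =>
    cases p with
    | nil => rfl
    | cons p c =>
      rw [Quiver.Path.comp_cons, Quiver.Path.comp_cons, firstArrow, ← Quiver.Path.comp_cons, ih]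
      rfl

end FirstArrow

/-! ### Splitting of `ψ` for injective representations -/

section Psi

variable {V : Type u} [Quiver.{u} V] {R : Type u} [Ring R]

/-- A path of positive length from `i` is uniquely an arrow followed by a path, so `ψ` is the
projection that forgets the coordinates at the trivial path. -/
theorem psi_coinduced_section (M : Paths V → ModuleCat.{u} R) (i : V) :
    ∃ σ, Rep.psi (coinduced M) i ∘ₗ σ = LinearMap.id := by
  -- The coordinate at the trivial path is unconstrained; it is set to `0` to keep the section
  -- linear.
  let val : ((a : Quiver.Star i) → CoinducedObj M ((Paths.of V).obj a.1)) →
      CoinducedObj M ((Paths.of V).obj i) := fun y p =>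
    (firstArrow (V := V) p.2).elim 0 fun x => y x.1 ⟨p.1, x.2⟩
  let σ : ((a : Quiver.Star i) → Rep.at (coinduced M) a.1) →ₗ[R] Rep.at (coinduced M) i :=
    { toFun := fun y => val y
      map_add' := fun y y' => by
        funext p
        change val (y + y') p = val y p + val y' p
        dsimp only [val]
        cases firstArrow (V := V) p.2
        · dsimp only [Option.elim]
          rw [add_zero]
        · rfl
      map_smul' := fun r y => by
        funext p
        change val (r • y) p = r • val y p
        dsimp only [val]
        cases firstArrow (V := V) p.2
        · dsimp only [Option.elim]
          rw [smul_zero]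
        · rfl }
  refine ⟨σ, LinearMap.ext fun y => funext fun a =>
    funext (f := (_ : CoinducedObj M ((Paths.of V).obj a.1))) fun p => ?_⟩
  exact congrArg (fun o => (Option.elim o 0 fun x => y x.1 ⟨p.1, x.2⟩ : M p.1))
    (firstArrow_toPath_comp (V := V) a.2 p.2)

/-- The section for the coinduced representation is transported along the retraction `r`. -/
theorem psi_section_of_injective (E : Rep V R) [Injective E] (i : V) :
    ∃ σ, Rep.psi E i ∘ₗ σ = LinearMap.id := by
  obtain ⟨σ, hσ⟩ := psi_coinduced_section (fun d => Injective.under (E.obj d)) i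
  let r := Injective.factorThru (𝟙 E) (injectiveHullι E)
  have hr : injectiveHullι E ≫ r = 𝟙 E := Injective.comp_factorThru _ _
  refine ⟨Rep.homAt r i ∘ₗ σ ∘ₗ LinearMap.pi fun a => Rep.homAt (injectiveHullι E) a.1 ∘ₗ
    LinearMap.proj a, LinearMap.ext fun y => funext fun a => ?_⟩
  have h1 := congrFun (LinearMap.congr_fun hσ fun a => Rep.homAt (injectiveHullι E) a.1 (y a)) a
  have h2 := ConcreteCategory.congr_hom (NatTrans.congr_app hr ((Paths.of V).obj a.1)) (y a)
  refine Eq.trans ?_ h2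
  refine (Rep.homAt_arrow r a.2 _).symm.trans ?_
  exact congrArg (Rep.homAt r a.1) h1

theorem fpLifting_psi_of_injective (E : Rep V R) [Injective E] (i : V) :
    FpLifting (Rep.psi E i) := fun P _ _ _ f => by
  obtain ⟨σ, hσ⟩ := psi_section_of_injective E i
  exact ⟨σ ∘ₗ f, by rw [← LinearMap.comp_assoc, hσ, LinearMap.id_comp]⟩

theorem stronglyFpInjectiveModule_at_of_injective (E : Rep V R) [Injective E] (i : V) :
    StronglyFpInjectiveModule (E.at i) :=
  have := injective_obj_of_injective E ((Paths.of V).obj i)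
  .of_injective _

end Psi

/-! ### Finite systems of linear equations in a functor to modules -/

section Systems

variable {R : Type u} [Ring R] {C : Type u} [SmallCategory C]

/-- The value at `c` of the free functor on generators `b : β` at `v b`. -/
abbrev FreeOn (R : Type u) [Ring R] {β : Type u} (v : β → C) (c : C) : Type u :=
  (Σ b, (v b ⟶ c)) →₀ R

/-- The action of a morphism on the free functor. -/
noncomputable def freePush {β : Type u} (v : β → C) {c c' : C} (q : c ⟶ c') :
    FreeOn R v c →ₗ[R] FreeOn R v c' :=
  Finsupp.lmapDomain R R fun p => ⟨p.1, p.2 ≫ q⟩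

/-- The evaluation of formal linear combinations at elements `y b` of `X (v b)`. -/
noncomputable def freeEval (X : C ⥤ ModuleCat.{u} R) {β : Type u} (v : β → C)
    (y : ∀ b, X.obj (v b)) (c : C) : FreeOn R v c →ₗ[R] X.obj c :=
  Finsupp.linearCombination R fun p => (X.map p.2).hom (y p.1)

section

variable (X : C ⥤ ModuleCat.{u} R) {β : Type u} (v : β → C)

@[simp]
theorem freePush_single {c c' : C} (q : c ⟶ c') (b : β) (p : v b ⟶ c) (r : R) :
    freePush v q (Finsupp.single ⟨b, p⟩ r) = Finsupp.single ⟨b, p ≫ q⟩ r :=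
  Finsupp.mapDomain_single

@[simp]
theorem freeEval_single (y : ∀ b, X.obj (v b)) {c : C} (b : β) (p : v b ⟶ c) (r : R) :
    freeEval X v y c (Finsupp.single ⟨b, p⟩ r) = r • (X.map p).hom (y b) :=
  Finsupp.linearCombination_single R r _

theorem freeEval_single_id (y : ∀ b, X.obj (v b)) (b : β) (r : R) :
    freeEval X v y (v b) (Finsupp.single ⟨b, 𝟙 _⟩ r) = r • y b := by
  rw [freeEval_single, X.map_id]
  rfl

theorem freeEval_push (y : ∀ b, X.obj (v b)) {c c' : C} (q : c ⟶ c') (ρ : FreeOn R v c) :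
    freeEval X v y c' (freePush v q ρ) = (X.map q).hom (freeEval X v y c ρ) := by
  have : freeEval X v y c' ∘ₗ freePush v q = (X.map q).hom ∘ₗ freeEval X v y c := by
    refine Finsupp.lhom_ext fun p r => ?_
    rw [LinearMap.comp_apply, LinearMap.comp_apply, freePush_single, freeEval_single,
      freeEval_single, X.map_comp, map_smul]
    rfl
  exact LinearMap.congr_fun this ρ

theorem app_freeEval {X Y : C ⥤ ModuleCat.{u} R} (f : X ⟶ Y) (y : ∀ b, X.obj (v b)) {c : C}
    (ρ : FreeOn R v c) :
    (f.app c).hom (freeEval X v y c ρ) = freeEval Y v (fun b => (f.app (v b)).hom (y b)) c ρ := by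
  have : (f.app c).hom ∘ₗ freeEval X v y c = freeEval Y v (fun b => (f.app (v b)).hom (y b)) c := by
    refine Finsupp.lhom_ext fun p r => ?_
    rw [LinearMap.comp_apply, freeEval_single, freeEval_single, map_smul]
    exact congrArg (r • ·) (ConcreteCategory.congr_hom (f.naturality p.2) (y p.1))
  exact LinearMap.congr_fun this ρ

theorem freeEval_add (y y' : ∀ b, X.obj (v b)) {c : C} (ρ : FreeOn R v c) :
    freeEval X v (y + y') c ρ = freeEval X v y c ρ + freeEval X v y' c ρ := by
  have : freeEval X v (y + y') c = freeEval X v y c + freeEval X v y' c := by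
    refine Finsupp.lhom_ext fun p r => ?_
    rw [LinearMap.add_apply, freeEval_single, freeEval_single, freeEval_single, Pi.add_apply,
      map_add, smul_add]
  exact LinearMap.congr_fun this ρ

/-- Evaluation at varying elements. -/
noncomputable def freeEvalHom {c : C} (ρ : FreeOn R v c) : (∀ b, X.obj (v b)) →+ X.obj c :=
  AddMonoidHom.mk' (fun y => freeEval X v y c ρ) fun y y' => freeEval_add X v y y' ρ

end

/-- Every finite system of linear equations with constants in `X` that is solvable in `E` is
solvable in `X`. -/
def SystemsSolvable {X E : C ⥤ ModuleCat.{u} R} (ε : X ⟶ E) : Prop :=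
  ∀ (β τ : Type u) [Finite β] [Finite τ] (v : β → C) (w : τ → C) (ρ : ∀ t, FreeOn R v (w t))
    (x : ∀ t, X.obj (w t)) (e : ∀ b, E.obj (v b)),
    (∀ t, freeEval E v e (w t) (ρ t) = (ε.app (w t)).hom (x t)) →
      ∃ y : ∀ b, X.obj (v b), ∀ t, freeEval X v y (w t) (ρ t) = x t

/-- The number of unknowns may be infinite. -/
theorem SystemsSolvable.exists_of_finite {X E : C ⥤ ModuleCat.{u} R} {ε : X ⟶ E}
    (h : SystemsSolvable ε) {β τ : Type u} [Finite τ] (v : β → C) (w : τ → C)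
    (ρ : ∀ t, FreeOn R v (w t)) (x : ∀ t, X.obj (w t)) (e : ∀ b, E.obj (v b))
    (he : ∀ t, freeEval E v e (w t) (ρ t) = (ε.app (w t)).hom (x t)) :
    ∃ y : ∀ b, X.obj (v b), ∀ t, freeEval X v y (w t) (ρ t) = x t := by
  classical
  let B : Set β := ⋃ t, Sigma.fst '' ((ρ t).support : Set (Σ b, (v b ⟶ w t)))
  have hB : B.Finite := Set.finite_iUnion fun t => (Finset.finite_toSet _).image _
  have : Finite B := hB
  let v' : B → C := fun b => v b
  let j : ∀ c, (Σ b, (v' b ⟶ c)) → Σ b, (v b ⟶ c) := fun c p => ⟨p.1, p.2⟩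
  have hj : ∀ c, Function.Injective (j c) := by
    rintro c ⟨⟨b, hb⟩, p⟩ ⟨⟨b', hb'⟩, p'⟩ hp
    obtain rfl : b = b' := congrArg Sigma.fst hp
    obtain rfl := eq_of_heq (Sigma.mk.inj hp).2
    rfl
  let ρ' : ∀ t, FreeOn R v' (w t) := fun t => (ρ t).comapDomain (j (w t)) (hj _).injOn
  have hρ' : ∀ t, Finsupp.mapDomain (j (w t)) (ρ' t) = ρ t := fun t => by
    refine Finsupp.mapDomain_comapDomain _ (hj _) _ fun p hp => ?_
    exact ⟨⟨⟨p.1, Set.mem_iUnion.2 ⟨t, p, hp, rfl⟩⟩, p.2⟩, rfl⟩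
  have key : ∀ (Y : C ⥤ ModuleCat.{u} R) (y : ∀ b, Y.obj (v b)) t,
      freeEval Y v y (w t) (ρ t) = freeEval Y v' (fun b => y b) (w t) (ρ' t) := fun Y y t => by
    rw [← hρ' t]
    exact Finsupp.linearCombination_mapDomain R (j (w t)) (ρ' t)
  obtain ⟨y, hy⟩ := h B τ v' w ρ' x (fun b => e b) fun t => by rw [← key, he]
  -- Only unknowns in `B` occur in the equations, so the others may be set to `0`.
  refine ⟨fun b => if hb : b ∈ B then y ⟨b, hb⟩ else 0, fun t => ?_⟩
  rw [key, ← hy t]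
  congr 1
  congr 1
  funext b
  exact dif_pos b.2

section Presented

variable {β τ : Type u} (v : β → C) (w : τ → C) (ρ : ∀ t, FreeOn R v (w t))

/-- The relations generated by `ρ`. -/
noncomputable def relations (c : C) : Submodule R (FreeOn R v c) :=
  Submodule.span R (Set.range fun q : (Σ t, (w t ⟶ c)) => freePush v q.2 (ρ q.1))

theorem relations_le_comap {c c' : C} (q : c ⟶ c') :
    relations v w ρ c ≤ (relations v w ρ c').comap (freePush v q) := by
  refine Submodule.span_le.2 ?_
  rintro _ ⟨⟨t, p⟩, rfl⟩
  refine Submodule.subset_span ⟨⟨t, p ≫ q⟩, ?_⟩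
  have : freePush v (p ≫ q) = freePush (R := R) v q ∘ₗ freePush v p := by
    refine Finsupp.lhom_ext fun p' r => ?_
    rw [LinearMap.comp_apply, freePush_single, freePush_single, freePush_single, Category.assoc]
  exact LinearMap.congr_fun this (ρ t)

/-- The functor with generators `b : β` at `v b` and relations `ρ`. -/
noncomputable def presented : C ⥤ ModuleCat.{u} R where
  obj c := ModuleCat.of R (FreeOn R v c ⧸ relations v w ρ c)
  map q := ModuleCat.ofHom (Submodule.mapQ _ _ (freePush v q) (relations_le_comap v w ρ q))
  map_id c := by
    refine ModuleCat.hom_ext (Submodule.linearMap_qext _ (Finsupp.lhom_ext fun p r => ?_))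
    refine congrArg (Submodule.mkQ _) ((freePush_single v _ _ _ _).trans ?_)
    rw [Category.comp_id]
  map_comp q q' := by
    refine ModuleCat.hom_ext (Submodule.linearMap_qext _ (Finsupp.lhom_ext fun p r => ?_))
    refine congrArg (Submodule.mkQ _) ((freePush_single v _ _ _ _).trans ?_)
    rw [freePush_single, freePush_single, Category.assoc]

/-- With finite hom-sets, finitely many global generators and relations contribute only finitely
many at each object. -/
theorem finitePresentation_presented [Finite β] [Finite τ] [∀ c d : C, Finite (c ⟶ d)] (c : C) :
    Module.FinitePresentation R ((presented v w ρ).obj c) := by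
  change Module.FinitePresentation R (FreeOn R v c ⧸ relations v w ρ c)
  refine Module.finitePresentation_of_surjective (relations v w ρ c).mkQ
    (Submodule.mkQ_surjective _) ?_
  rw [Submodule.ker_mkQ]
  exact Submodule.fg_span (Set.finite_range _)

variable {v w ρ}

/-- The morphism from `presented v w ρ` given by elements satisfying the relations. -/
noncomputable def presentedLift {Y : C ⥤ ModuleCat.{u} R} (y : ∀ b, Y.obj (v b))
    (hy : ∀ t, freeEval Y v y (w t) (ρ t) = 0) : presented v w ρ ⟶ Y where
  app c := ModuleCat.ofHom (Submodule.liftQ _ (freeEval Y v y c) (by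
    refine Submodule.span_le.2 ?_
    rintro _ ⟨⟨t, p⟩, rfl⟩
    change freeEval Y v y c (freePush v p (ρ t)) = 0
    rw [freeEval_push, hy, map_zero]))
  naturality c c' q :=
    ModuleCat.hom_ext (Submodule.linearMap_qext _ (LinearMap.ext fun σ => freeEval_push Y v y q σ))

/-- A solution `e` in `E` becomes in `Y` a solution of the homogeneous system, that is, a morphism
from the presented functor. Lifting it gives a homogeneous solution `k` in `E` with the same image
as `e`, and `e - k` then comes from a solution in `X`. -/
theorem SystemsSolvable.of_lifting {X E Y : C ⥤ ModuleCat.{u} R} {ε : X ⟶ E} {π : E ⟶ Y}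
    [∀ c d : C, Finite (c ⟶ d)] (hε : ∀ c, Function.Injective (ε.app c).hom)
    (hεπ : ∀ c, Function.Exact (ε.app c).hom (π.app c).hom)
    (hlift : ∀ F : C ⥤ ModuleCat.{u} R, (∀ c, Module.FinitePresentation R (F.obj c)) →
      ∀ f : F ⟶ Y, ∃ h : F ⟶ E, h ≫ π = f) : SystemsSolvable ε := by
  intro β τ _ _ v w ρ x e he
  have hy : ∀ t, freeEval Y v (fun b => (π.app (v b)).hom (e b)) (w t) (ρ t) = 0 := fun t => by
    rw [← app_freeEval, he, (hεπ _).apply_apply_eq_zero]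
  obtain ⟨h, hh⟩ := hlift _ (finitePresentation_presented v w ρ) (presentedLift _ hy)
  let g : ∀ c, FreeOn R v c →ₗ[R] E.obj c := fun c => (h.app c).hom ∘ₗ (relations v w ρ c).mkQ
  let k : ∀ b, E.obj (v b) := fun b => g (v b) (Finsupp.single ⟨b, 𝟙 _⟩ 1)
  have hk : ∀ c σ, freeEval E v k c σ = g c σ := fun c => LinearMap.congr_fun <| by
    refine Finsupp.lhom_ext fun p r => ?_
    rw [freeEval_single, ← map_smul]
    have h1 := ConcreteCategory.congr_hom (h.naturality p.2)
      ((relations v w ρ (v p.1)).mkQ (Finsupp.single ⟨p.1, 𝟙 _⟩ r))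
    have h2 : freePush (R := R) v p.2 (Finsupp.single ⟨p.1, 𝟙 _⟩ r) = Finsupp.single p r := by
      rw [freePush_single, Category.id_comp]
    have h3 : r • k p.1 = g (v p.1) (Finsupp.single ⟨p.1, 𝟙 _⟩ r) := by
      rw [← map_smul, Finsupp.smul_single, smul_eq_mul, mul_one]
    rw [h3]
    refine h1.symm.trans ?_
    exact congrArg (fun σ => (h.app c).hom ((relations v w ρ c).mkQ σ)) h2
  have hρ : ∀ t, freeEval E v k (w t) (ρ t) = 0 := fun t => by
    rw [hk]
    have : (relations v w ρ (w t)).mkQ (ρ t) = 0 := by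
      rw [Submodule.mkQ_apply, Submodule.Quotient.mk_eq_zero]
      refine Submodule.subset_span ⟨⟨t, 𝟙 _⟩, ?_⟩
      have : freePush (R := R) v (𝟙 (w t)) = LinearMap.id := Finsupp.lhom_ext fun p r => by
        rw [freePush_single, Category.comp_id]
        rfl
      exact LinearMap.congr_fun this (ρ t)
    change (h.app (w t)).hom ((relations v w ρ (w t)).mkQ (ρ t)) = 0
    exact (congrArg (h.app (w t)).hom this).trans (map_zero _)
  have hπ : ∀ b, (π.app (v b)).hom (k b) = (π.app (v b)).hom (e b) := fun b => by
    have h1 := ConcreteCategory.congr_hom (NatTrans.congr_app hh (v b))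
      ((relations v w ρ (v b)).mkQ (Finsupp.single ⟨b, 𝟙 _⟩ 1))
    refine h1.trans ?_
    exact (freeEval_single_id Y v (fun b => (π.app (v b)).hom (e b)) b 1).trans (one_smul R _)
  have hy' : ∀ b, ∃ y, (ε.app (v b)).hom y = (e - k) b := fun b =>
    (hεπ (v b) _).1 (by rw [Pi.sub_apply, map_sub, hπ, sub_self])
  choose y hy' using hy'
  refine ⟨y, fun t => hε _ ?_⟩
  rw [app_freeEval, ← he t]
  simp only [hy']
  refine ((freeEvalHom E v (ρ t)).map_sub e k).trans ?_
  exact (congrArg _ (hρ t)).trans (sub_zero _)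

end Presented

end Systems

/-! ### The character dual of a representation -/

section Dual

variable {R : Type u} [Ring R]

/-- The group of characters of a left module, as a right module. -/
abbrev CharDual (A : Type u) [AddCommGroup A] : Type u := A →+ AddCircle (1 : ℚ)

/-- The action `(χ r) a = χ (r a)`. -/
instance (A : Type u) [AddCommGroup A] [Module R A] : Module Rᵐᵒᵖ (CharDual A) where
  smul r χ := χ.comp (DistribSMul.toAddMonoidHom A r.unop)
  one_smul χ := AddMonoidHom.ext fun a => congrArg χ (one_smul R a)
  mul_smul r r' χ := AddMonoidHom.ext fun a => congrArg χ (mul_smul r'.unop r.unop a)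
  smul_zero _ := rfl
  smul_add _ _ _ := rfl
  add_smul r r' χ := AddMonoidHom.ext fun a =>
    (congrArg χ (add_smul r.unop r'.unop a)).trans (map_add χ _ _)
  zero_smul χ := AddMonoidHom.ext fun a => (congrArg χ (zero_smul R a)).trans (map_zero χ)

/-- Precomposition with a linear map. -/
def CharDual.map {A B : Type u} [AddCommGroup A] [Module R A] [AddCommGroup B] [Module R B]
    (f : A →ₗ[R] B) : CharDual B →ₗ[Rᵐᵒᵖ] CharDual A where
  toFun χ := χ.comp f.toAddMonoidHom
  map_add' _ _ := rfl
  map_smul' r χ := AddMonoidHom.ext fun a => congrArg χ (f.map_smul r.unop a).symm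

variable {V : Type u} [Quiver.{u} V]

/-- The character dual `Hom_ℤ(X, ℚ/ℤ)` of a representation. -/
def charRep (X : Rep V R) : Rep Vᵒᵖ Rᵐᵒᵖ :=
  Paths.lift
    { obj := fun i => ModuleCat.of Rᵐᵒᵖ (CharDual (X.at i.unop))
      map := fun a => ModuleCat.ofHom (CharDual.map (X.arrow a.unop)) }

theorem charRep_arrow (X : Rep V R) {i j : V} (a : i ⟶ j) (χ : CharDual (X.at j)) :
    (charRep X).arrow a.op χ = χ.comp (X.arrow a).toAddMonoidHom := by
  have := Paths.lift_toPath
    { obj := fun i : Vᵒᵖ => ModuleCat.of Rᵐᵒᵖ (CharDual (X.at i.unop))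
      map := fun a => ModuleCat.ofHom (CharDual.map (X.arrow a.unop)) } a.op
  exact ConcreteCategory.congr_hom this χ

/-- The element `χ ⊗ e` of the tensor product with the character dual. -/
def charMk (X E : Rep V R) (c : Paths V) (χ : CharDual (X.obj c)) (e : E.obj c) :
    Tensor (charRep X) E :=
  Tensor.mk (charRep X) E c χ e

theorem map_charMk {X E : Rep V R} (ε : X ⟶ E) (c : Paths V) (χ : CharDual (X.obj c))
    (x : X.obj c) :
    Tensor.map (charRep X) ε (charMk X X c χ x) = charMk X E c χ ((ε.app c).hom x) :=
  Tensor.map_mk (S := charRep X) ε c χ x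

/-- The evaluation of characters. -/
def charEval (X : Rep V R) : Tensor (charRep X) X →+ AddCircle (1 : ℚ) :=
  Tensor.lift (fun i (χ : CharDual (X.at i)) y => χ y) (fun _ _ _ _ => rfl)
    (fun i (χ : CharDual (X.at i)) y y' => map_add χ y y') (fun _ _ _ _ => rfl)
    (fun {_ j} a (χ : CharDual (X.at j)) y => DFunLike.congr_fun (F := CharDual _)
      (charRep_arrow X a χ) y)

theorem charEval_charMk (X : Rep V R) (c : Paths V) (χ : CharDual (X.obj c)) (x : X.obj c) :
    charEval X (charMk X X c χ x) = χ x :=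
  FreeAbelianGroup.lift_apply_of _ _

theorem charMk_add (X E : Rep V R) (c : Paths V) (χ : CharDual (X.obj c)) (e e' : E.obj c) :
    charMk X E c χ (e + e') = charMk X E c χ e + charMk X E c χ e' :=
  Tensor.mk_add (charRep X) E c χ e e'

theorem add_charMk (X E : Rep V R) (c : Paths V) (χ χ' : CharDual (X.obj c)) (e : E.obj c) :
    charMk X E c (χ + χ') e = charMk X E c χ e + charMk X E c χ' e :=
  Tensor.add_mk (charRep X) E c χ χ' e

theorem charMk_zero (X E : Rep V R) (c : Paths V) (χ : CharDual (X.obj c)) :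
    charMk X E c χ 0 = 0 :=
  map_zero (Tensor.mkLeft (charRep X) E c χ)

theorem zero_charMk (X E : Rep V R) (c : Paths V) (e : E.obj c) : charMk X E c 0 e = 0 :=
  map_zero (Tensor.mkRight (charRep X) E c e)

theorem charMk_smul (X E : Rep V R) (c : Paths V) (χ : CharDual (X.obj c)) (r : R) (e : E.obj c) :
    charMk X E c χ (r • e) = charMk X E c (χ.comp (DistribSMul.toAddMonoidHom _ r)) e :=
  (Tensor.op_smul_mk (charRep X) E c χ r e).symm

/-- The tensor relation for single arrows extends to paths by induction on the length. -/
theorem charMk_map (X E : Rep V R) {c d : Paths V} (p : c ⟶ d) (χ : CharDual (X.obj d))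
    (e : E.obj c) :
    charMk X E d χ ((E.map p).hom e) = charMk X E c (χ.comp (X.map p).hom.toAddMonoidHom) e := by
  induction p using Paths.induction_fixed_source with
  | id => rw [E.map_id, X.map_id]; rfl
  | comp p a ih =>
    rw [E.map_comp, X.map_comp]
    refine Eq.trans (Tensor.arrow_mk (charRep X) E a χ ((E.map p).hom e)).symm ?_
    rw [charRep_arrow]
    exact ih (χ.comp (X.arrow a).toAddMonoidHom)

/-- The coefficients and paths in `ρ` move across the tensor sign from `E` to the character, where
they act through `X`. -/
theorem charMk_freeEval_single (X E : Rep V R) {β : Type u} [DecidableEq β] (v : β → Paths V)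
    (b : β) (e : E.obj (v b)) {c : Paths V} (ρ : FreeOn R v c) (χ : CharDual (X.obj c)) :
    charMk X E c χ (freeEval E v (Pi.single b e) c ρ) = charMk X E (v b)
      (χ.comp ((freeEvalHom X v ρ).comp (AddMonoidHom.single (fun b => X.obj (v b)) b))) e := by
  induction ρ using Finsupp.induction_linear with
  | zero =>
    have : χ.comp ((freeEvalHom X v (0 : FreeOn R v c)).comp
        (AddMonoidHom.single (fun b => X.obj (v b)) b)) = 0 :=
      AddMonoidHom.ext fun x =>
        (congrArg χ (map_zero (freeEval X v (Pi.single b x) c))).trans (map_zero χ)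
    rw [this, map_zero, charMk_zero, zero_charMk]
  | add ρ ρ' h h' =>
    rw [map_add, charMk_add, h, h', ← add_charMk]
    congr 1
    refine AddMonoidHom.ext fun x => ?_
    exact (map_add χ _ _).symm.trans (congrArg χ (map_add (freeEval X v _ c) ρ ρ').symm)
  | single p r =>
    obtain ⟨b', p⟩ := p
    rw [freeEval_single]
    obtain rfl | hb := eq_or_ne b' b
    · rw [Pi.single_eq_same, charMk_smul, charMk_map]
      congr 1
      refine AddMonoidHom.ext fun x => congrArg χ ?_
      refine Eq.trans ?_ (freeEval_single X v (Pi.single b' x) b' p r).symm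
      rw [Pi.single_eq_same]
      rfl
    · rw [Pi.single_eq_of_ne hb, map_zero, smul_zero, charMk_zero]
      have : χ.comp ((freeEvalHom X v (Finsupp.single ⟨b', p⟩ r)).comp
          (AddMonoidHom.single (fun b => X.obj (v b)) b)) = 0 := by
        refine AddMonoidHom.ext fun x => ?_
        refine (congrArg χ ((freeEval_single X v (Pi.single b x) b' p r).trans ?_)).trans
          (map_zero χ)
        rw [Pi.single_eq_of_ne hb, map_zero, smul_zero]
      rw [this, zero_charMk]

/-- If `X → E` stays injective after tensoring, finite systems of linear equations solvable in `E`
are solvable in `X`. -/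
theorem SystemsSolvable.of_tensor_injective {X E : Rep V R} {ε : X ⟶ E}
    (h : Function.Injective (Tensor.map (charRep X) ε)) : SystemsSolvable ε := by
  classical
  intro β τ _ _ v w ρ x e he
  have := Fintype.ofFinite β
  have := Fintype.ofFinite τ
  let θ : (∀ b, X.obj (v b)) →+ (∀ t, X.obj (w t)) := AddMonoidHom.pi fun t => freeEvalHom X v (ρ t)
  suffices hx : (QuotientAddGroup.mk x : _ ⧸ θ.range) = 0 by
    obtain ⟨y, hy⟩ := (QuotientAddGroup.eq_zero_iff x).1 hx
    exact ⟨y, fun t => congrFun hy t⟩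
  by_contra hx
  -- If `x` is not of the form `θ y`, some character vanishes on the range of `θ` but not at `x`.
  -- Its components `χt` give the tensor `z = ∑ χt ⊗ x t`, which evaluates to `χ' x ≠ 0` although
  -- its image in the tensor product with `E` is zero.
  obtain ⟨χ, hχ⟩ := CharacterModule.exists_character_apply_ne_zero_of_ne_zero hx
  let χ' : (∀ t, X.obj (w t)) →+ AddCircle (1 : ℚ) :=
    AddMonoidHom.comp (χ : (_ ⧸ θ.range) →+ AddCircle (1 : ℚ)) (QuotientAddGroup.mk' θ.range)
  have hθ : ∀ y, χ' (θ y) = 0 := fun y => by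
    have : (QuotientAddGroup.mk (θ y) : _ ⧸ θ.range) = 0 :=
      (QuotientAddGroup.eq_zero_iff _).2 ⟨y, rfl⟩
    exact (congrArg χ this).trans (map_zero _)
  let χt : ∀ t, CharDual (X.obj (w t)) := fun t =>
    χ'.comp (AddMonoidHom.single (fun t => X.obj (w t)) t)
  have hsum : ∀ z, ∑ t, χt t (z t) = χ' z := fun z => by
    conv_rhs => rw [← Finset.univ_sum_single z, map_sum]
    rfl
  let z : Tensor (charRep X) X := ∑ t, charMk X X (w t) (χt t) (x t)
  have hz : z = 0 := by
    refine h ?_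
    rw [map_zero, map_sum]
    have h1 : ∀ t, Tensor.map (charRep X) ε (charMk X X (w t) (χt t) (x t)) =
        charMk X E (w t) (χt t) (freeEval E v e (w t) (ρ t)) := fun t => by
      rw [he, map_charMk]
    rw [Finset.sum_congr rfl fun t _ => h1 t]
    let Φ : (∀ b, E.obj (v b)) →+ Tensor (charRep X) E :=
      AddMonoidHom.mk' (fun e' => ∑ t, charMk X E (w t) (χt t) (freeEval E v e' (w t) (ρ t)))
        fun e₁ e₂ => by simp only [freeEval_add, charMk_add, Finset.sum_add_distrib]
    suffices Φ = 0 from DFunLike.congr_fun this e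
    -- By additivity one unknown `b` suffices. Moving the equations across the tensor sign leaves a
    -- single character of `X (v b)`, the restriction of `χ' ∘ θ`, which is zero.
    refine AddMonoidHom.functions_ext' _ _ _ fun b => AddMonoidHom.ext fun e' => ?_
    refine (Finset.sum_congr rfl fun t _ => charMk_freeEval_single X E v b e' (ρ t) (χt t)).trans ?_
    refine (map_sum (Tensor.mkRight (charRep X) E (v b) e') _ _).symm.trans ?_
    refine Eq.trans (congrArg _ ?_) (map_zero (Tensor.mkRight (charRep X) E (v b) e'))
    refine AddMonoidHom.ext fun y => ?_
    refine (AddMonoidHom.finsetSum_apply _ _ _).trans ?_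
    refine (hsum (θ (Pi.single b y))).trans ?_
    exact hθ _
  refine hχ ?_
  have h2 : charEval X z = χ' x := by
    rw [map_sum, ← hsum]
    exact Finset.sum_congr rfl fun t _ => charEval_charMk X _ _ _
  rw [hz, map_zero] at h2
  exact h2.symm

end Dual

/-! ### Solvability of systems gives injectivity after tensoring -/

section Tensor

variable {V : Type u} [Quiver.{u} V] {R : Type u} [Ring R] {X E : Rep V R} (ε : X ⟶ E)

/-- All formal linear combinations of elements of `E`. -/
abbrev Formal (E : Rep V R) (c : Paths V) : Type u :=
  FreeOn R (Sigma.fst : (Σ c : Paths V, E.obj c) → Paths V) c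

/-- The value of a formal linear combination. -/
noncomputable abbrev formalEval (E : Rep V R) (c : Paths V) : Formal E c →ₗ[R] E.obj c :=
  freeEval E Sigma.fst (fun b => b.2) c

/-- The function `θ` from `E` to `X` respects the formal linear combination `ρ`. -/
def Respects (θ : ∀ b : (Σ c : Paths V, E.obj c), X.obj b.1) (ρ : Σ c, Formal E c) : Prop :=
  (ε.app ρ.1).hom (freeEval X Sigma.fst θ ρ.1 ρ.2) = formalEval E ρ.1 ρ.2

variable {ε}

/-- Each element of `E` is taken as an unknown. In `E` the system is solved by letting every unknown
stand for itself; a solution in `X` is the required `θ`. -/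
theorem SystemsSolvable.exists_respects (h : SystemsSolvable ε) (T : Set (Σ c, Formal E c))
    (hT : T.Finite) (hT' : ∀ ρ ∈ T, formalEval E ρ.1 ρ.2 ∈ Set.range (ε.app ρ.1).hom) :
    ∃ θ, ∀ ρ ∈ T, Respects ε θ ρ := by
  choose x hx using hT'
  have : Finite T := hT
  obtain ⟨θ, hθ⟩ := h.exists_of_finite (τ := T) _ (fun t => t.1.1) (fun t => t.1.2)
    (fun t => x t.1 t.2) (fun b => b.2) fun t => (hx t.1 t.2).symm
  refine ⟨θ, fun ρ hρ => ?_⟩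
  have := hθ ⟨ρ, hρ⟩
  unfold Respects
  rw [this, hx]

/-- The function induced by `θ : E → X` on formal sums of pairs. -/
def formalMap (S : Rep Vᵒᵖ Rᵐᵒᵖ) (θ : ∀ b : (Σ c : Paths V, E.obj c), X.obj b.1) :
    FreeAbelianGroup (Σ i : V, S.at (Opposite.op i) × E.at i) →+
      FreeAbelianGroup (Σ i : V, S.at (Opposite.op i) × X.at i) :=
  FreeAbelianGroup.map fun p => ⟨p.1, p.2.1, θ ⟨(Paths.of V).obj p.1, p.2.2⟩⟩

theorem formalMap_of (S : Rep Vᵒᵖ Rᵐᵒᵖ) (θ : ∀ b : (Σ c : Paths V, E.obj c), X.obj b.1) (i : V)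
    (s : S.at (Opposite.op i)) (e : E.at i) : formalMap S θ (FreeAbelianGroup.of ⟨i, s, e⟩) =
      FreeAbelianGroup.of ⟨i, s, θ ⟨(Paths.of V).obj i, e⟩⟩ :=
  FreeAbelianGroup.map_of_apply _

/-- The formal linear combination `r e`. -/
noncomputable abbrev formalSingle {c d : Paths V} (p : c ⟶ d) (r : R) (e : E.obj c) : Formal E d :=
  Finsupp.single ⟨⟨c, e⟩, p⟩ r

/-- Membership in the closure is witnessed by finitely many relations, each resting on at most one
linear identity in `E`. A function `θ` respecting these identities carries the witness over to `X`,
even if it is not linear. -/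
theorem exists_finite_formalMap_mem (hε : ∀ c, Function.Injective (ε.app c).hom)
    (S : Rep Vᵒᵖ Rᵐᵒᵖ) {z : FreeAbelianGroup (Σ i : V, S.at (Opposite.op i) × E.at i)}
    (hz : z ∈ AddSubgroup.closure {z | TensorRel S E z}) :
    ∃ T : Set (Σ c, Formal E c), T.Finite ∧
      (∀ ρ ∈ T, formalEval E ρ.1 ρ.2 ∈ Set.range (ε.app ρ.1).hom) ∧
      ∀ θ, (∀ ρ ∈ T, Respects ε θ ρ) →
        formalMap S θ z ∈ AddSubgroup.closure {z | TensorRel S X z} := by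
  have single_case : ∀ {c : Paths V} (ρ : Formal E c)
      {z : FreeAbelianGroup (Σ i : V, S.at (Opposite.op i) × E.at i)}, formalEval E c ρ = 0 →
      (∀ θ, freeEval X Sigma.fst θ c ρ = 0 →
        formalMap S θ z ∈ AddSubgroup.closure {z | TensorRel S X z}) →
      ∃ T : Set (Σ c, Formal E c), T.Finite ∧
        (∀ ρ ∈ T, formalEval E ρ.1 ρ.2 ∈ Set.range (ε.app ρ.1).hom) ∧
        ∀ θ, (∀ ρ ∈ T, Respects ε θ ρ) →
          formalMap S θ z ∈ AddSubgroup.closure {z | TensorRel S X z} := by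
    intro c ρ z h0 hz
    refine ⟨{⟨c, ρ⟩}, Set.finite_singleton _, ?_, fun θ hθ => hz θ (hε c ?_)⟩
    · rintro _ rfl
      exact ⟨0, (map_zero _).trans h0.symm⟩
    · have := hθ _ rfl
      exact this.trans (h0.trans (map_zero _).symm)
  induction hz using AddSubgroup.closure_induction with
  | mem z hz =>
    rcases hz with ⟨i, s, s', x⟩ | ⟨i, s, x, x'⟩ | ⟨i, s, r, x⟩ | ⟨a, s, x⟩
    -- Additivity in `s` involves only one element of `E`, so it puts no condition on `θ`.
    · refine single_case (0 : Formal E i) (map_zero _) fun θ _ => AddSubgroup.subset_closure ?_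
      rw [map_sub, map_sub, formalMap_of, formalMap_of, formalMap_of]
      exact .add_left _ _ _ _
    · refine single_case (formalSingle (𝟙 _) 1 (x + x') - formalSingle (𝟙 _) 1 x -
        formalSingle (𝟙 _) 1 x') ?_ fun θ hθ => AddSubgroup.subset_closure ?_
      · simp
      · rw [map_sub, map_sub, formalMap_of, formalMap_of, formalMap_of]
        have : θ ⟨(Paths.of V).obj i, x + x'⟩ =
            θ ⟨(Paths.of V).obj i, x⟩ + θ ⟨(Paths.of V).obj i, x'⟩ := by
          simpa [sub_sub, sub_eq_zero] using hθ
        rw [this]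
        exact .add_right _ _ _ _
    · refine single_case (formalSingle (𝟙 _) 1 (r • x) - formalSingle (𝟙 _) r x) ?_
        fun θ hθ => AddSubgroup.subset_closure ?_
      · simp
      · rw [map_sub, formalMap_of, formalMap_of]
        have : θ ⟨(Paths.of V).obj i, r • x⟩ = r • θ ⟨(Paths.of V).obj i, x⟩ := by
          simpa [sub_eq_zero] using hθ
        rw [this]
        exact .balanced _ _ _ _
    · rename_i i j
      refine single_case (formalSingle (𝟙 _) 1 (E.arrow a x) -
        formalSingle ((Paths.of V).map a) 1 x) ?_ fun θ hθ => AddSubgroup.subset_closure ?_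
      · rw [map_sub, freeEval_single, freeEval_single, E.map_id, one_smul, one_smul]
        exact sub_self _
      · rw [map_sub, formalMap_of, formalMap_of]
        rw [map_sub, freeEval_single, freeEval_single, X.map_id, one_smul, one_smul,
          sub_eq_zero] at hθ
        have : θ ⟨(Paths.of V).obj j, E.arrow a x⟩ = X.arrow a (θ ⟨(Paths.of V).obj i, x⟩) := hθ
        rw [this]
        exact .arrow _ _ _
  | zero => exact ⟨∅, Set.finite_empty, by simp, fun θ _ => by rw [map_zero]; exact zero_mem _⟩
  | add z w _ _ hz hw =>
    obtain ⟨T, h1, h2, h3⟩ := hz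
    obtain ⟨T', h1', h2', h3'⟩ := hw
    refine ⟨T ∪ T', h1.union h1', fun ρ hρ => hρ.elim (h2 ρ) (h2' ρ), fun θ hθ => ?_⟩
    rw [map_add]
    exact add_mem (h3 θ fun ρ hρ => hθ ρ (.inl hρ)) (h3' θ fun ρ hρ => hθ ρ (.inr hρ))
  | neg z _ hz =>
    obtain ⟨T, h1, h2, h3⟩ := hz
    refine ⟨T, h1, h2, fun θ hθ => ?_⟩
    rw [map_neg]
    exact neg_mem (h3 θ hθ)

/-- Only finitely many elements of `X` occur in `z`; it is enough that `θ` inverts `ε` on these. -/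
theorem exists_finite_formalMap_map (hε : ∀ c, Function.Injective (ε.app c).hom)
    (S : Rep Vᵒᵖ Rᵐᵒᵖ) (z : FreeAbelianGroup (Σ i : V, S.at (Opposite.op i) × X.at i)) :
    ∃ T : Set (Σ c, Formal E c), T.Finite ∧
      (∀ ρ ∈ T, formalEval E ρ.1 ρ.2 ∈ Set.range (ε.app ρ.1).hom) ∧
      ∀ θ, (∀ ρ ∈ T, Respects ε θ ρ) →
        formalMap S θ
          (FreeAbelianGroup.map (fun p => ⟨p.1, p.2.1, Rep.homAt ε p.1 p.2.2⟩) z) = z := by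
  induction z using FreeAbelianGroup.induction_on with
  | zero => exact ⟨∅, Set.finite_empty, by simp, fun θ _ => by rw [map_zero, map_zero]⟩
  | of p =>
    obtain ⟨i, s, x⟩ := p
    refine ⟨{⟨_, formalSingle (𝟙 ((Paths.of V).obj i)) 1 (Rep.homAt ε i x)⟩},
      Set.finite_singleton _, ?_, fun θ hθ => ?_⟩
    · rintro _ rfl
      exact ⟨x, by simp⟩
    · rw [FreeAbelianGroup.map_of_apply, formalMap_of]
      have h1 := hθ _ rfl
      unfold Respects at h1
      have h2 : θ ⟨(Paths.of V).obj i, Rep.homAt ε i x⟩ = x := hε _ (by simpa using h1)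
      rw [h2]
  | neg p hp =>
    obtain ⟨T, h1, h2, h3⟩ := hp
    exact ⟨T, h1, h2, fun θ hθ => by rw [map_neg, map_neg, h3 θ hθ]⟩
  | add z w hz hw =>
    obtain ⟨T, h1, h2, h3⟩ := hz
    obtain ⟨T', h1', h2', h3'⟩ := hw
    refine ⟨T ∪ T', h1.union h1', fun ρ hρ => hρ.elim (h2 ρ) (h2' ρ), fun θ hθ => ?_⟩
    rw [map_add, map_add, h3 θ fun ρ hρ => hθ ρ (.inl hρ), h3' θ fun ρ hρ => hθ ρ (.inr hρ)]

theorem SystemsSolvable.tensor_injective (h : SystemsSolvable ε)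
    (hε : ∀ c, Function.Injective (ε.app c).hom) (S : Rep Vᵒᵖ Rᵐᵒᵖ) :
    Function.Injective (Tensor.map S ε) := by
  rw [injective_iff_map_eq_zero]
  intro z hz
  obtain ⟨z, rfl⟩ := QuotientAddGroup.mk_surjective z
  obtain ⟨T, h1, h2, h3⟩ := exists_finite_formalMap_mem hε S ((QuotientAddGroup.eq_zero_iff _).1 hz)
  obtain ⟨T', h1', h2', h3'⟩ := exists_finite_formalMap_map hε S z
  obtain ⟨θ, hθ⟩ := h.exists_respects (T ∪ T') (h1.union h1') fun ρ hρ => hρ.elim (h2 ρ) (h2' ρ)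
  have h4 := h3 θ fun ρ hρ => hθ ρ (.inl hρ)
  rw [h3' θ fun ρ hρ => hθ ρ (.inr hρ)] at h4
  exact (QuotientAddGroup.eq_zero_iff _).2 h4

end Tensor

/-! ### Right rooted quivers -/

section Quivers

variable {V : Type u} [Quiver.{u} V]

/-- Transfinite induction: all arrows from a vertex of `W (β + 1)` end in earlier stages. -/
theorem acc_of_mem_W (α : Ordinal.{u}) :
    ∀ i ∈ W V α, Acc (fun j i : V => Nonempty (i ⟶ j)) i := by
  induction α using WellFoundedLT.induction with
  | ind α ih =>
    intro i hi
    rw [W] at hi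
    obtain ⟨β, rfl, h⟩ | ⟨-, β, hβ, h⟩ := hi
    · refine ⟨i, fun j ⟨a⟩ => ?_⟩
      obtain ⟨γ, hγ, hj⟩ := h j a
      exact ih γ (Order.lt_add_one_iff.2 hγ) j hj
    · exact ih β hβ i h

theorem RightRooted.wellFounded (h : RightRooted V) :
    WellFounded fun j i : V => Nonempty (i ⟶ j) := by
  obtain ⟨α, hα⟩ := h
  exact ⟨fun i => acc_of_mem_W α i (hα ▸ Set.mem_univ i)⟩

/-- By well-founded induction on `i` even the set of all paths starting at `i` is finite: such a
path is trivial or one of finitely many arrows followed by a path from its target. -/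
theorem LocallyTargetFinite.finite_path (hfin : LocallyTargetFinite V)
    (hwf : WellFounded fun j i : V => Nonempty (i ⟶ j)) (i j : V) : Finite (Quiver.Path i j) := by
  suffices h : ∀ i : V, Finite (Σ j, Quiver.Path i j) from
    have := h i
    Finite.of_injective (fun p : Quiver.Path i j => (⟨j, p⟩ : Σ j, Quiver.Path i j))
      sigma_mk_injective
  intro i
  induction i using hwf.induction with
  | _ i ih =>
    have := hfin i
    have : ∀ a : Quiver.Star i, Finite (Σ j, Quiver.Path a.1 j) := fun a => ih a.1 ⟨a.2⟩
    let f : Option (Σ a : Quiver.Star i, Σ j, Quiver.Path a.1 j) → Σ j, Quiver.Path i j := fun o =>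
      o.elim ⟨i, .nil⟩ fun x => ⟨x.2.1, x.1.2.toPath.comp x.2.2⟩
    refine Finite.of_surjective f ?_
    rintro ⟨j, p⟩
    generalize hn : p.length = n
    cases n with
    | zero =>
      obtain rfl := Quiver.Path.eq_of_length_zero p hn
      rw [Quiver.Path.eq_nil_of_length_zero p hn]
      exact ⟨none, rfl⟩
    | succ n =>
      obtain ⟨k, a, q, -, rfl⟩ := p.eq_toPath_comp_of_length_eq_succ hn
      exact ⟨some ⟨⟨k, a⟩, ⟨j, q⟩⟩, rfl⟩

end Quivers

section Modules

variable {R : Type u} [Ring R] {L M N P : Type u} [AddCommGroup L] [Module R L] [AddCommGroup M]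
  [Module R M] [AddCommGroup N] [Module R N] [AddCommGroup P] [Module R P]

theorem exists_comp_eq_of_exact {f : L →ₗ[R] M} {g : M →ₗ[R] N} (hf : Function.Injective f)
    (hfg : Function.Exact f g) (k : P →ₗ[R] M) (hk : ∀ x, g (k x) = 0) :
    ∃ l : P →ₗ[R] L, ∀ x, f (l x) = k x := by
  refine ⟨(LinearEquiv.ofInjective f hf).symm ∘ₗ k.codRestrict (LinearMap.range f)
    fun x => (hfg _).1 (hk x), fun x => ?_⟩
  rw [LinearMap.comp_apply]
  exact congrArg Subtype.val ((LinearEquiv.ofInjective f hf).apply_symm_apply _)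

end Modules

/-! ### Vertexwise lifting and purity -/

section Reps

variable {R : Type u} [Ring R]

section Functors

variable {C : Type u} [SmallCategory C]

/-- The quotient of a functor by the image of a morphism, computed objectwise. -/
def quotFunctor {X E : C ⥤ ModuleCat.{u} R} (ε : X ⟶ E) : C ⥤ ModuleCat.{u} R where
  obj c := ModuleCat.of R (E.obj c ⧸ LinearMap.range (ε.app c).hom)
  map {c d} q := ModuleCat.ofHom (Submodule.mapQ _ (LinearMap.range (ε.app d).hom) (E.map q).hom (by
    rintro _ ⟨x, rfl⟩
    exact ⟨(X.map q).hom x, ConcreteCategory.congr_hom (ε.naturality q) x⟩))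
  map_id c := by
    refine ModuleCat.hom_ext (Submodule.linearMap_qext _ (LinearMap.ext fun x => ?_))
    exact congrArg (Submodule.mkQ _) (ConcreteCategory.congr_hom (E.map_id c) x)
  map_comp q q' := by
    refine ModuleCat.hom_ext (Submodule.linearMap_qext _ (LinearMap.ext fun x => ?_))
    exact congrArg (Submodule.mkQ _) (ConcreteCategory.congr_hom (E.map_comp q q') x)

/-- The projection to the objectwise quotient. -/
def quotFunctorπ {X E : C ⥤ ModuleCat.{u} R} (ε : X ⟶ E) : E ⟶ quotFunctor ε where
  app c := ModuleCat.ofHom (Submodule.mkQ _)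

/-- The morphism from the objectwise quotient induced by a morphism that vanishes on the image. -/
def quotFunctorDesc {X E F : C ⥤ ModuleCat.{u} R} (ε : X ⟶ E) (d : E ⟶ F)
    (h : ∀ c x, (d.app c).hom ((ε.app c).hom x) = 0) : quotFunctor ε ⟶ F where
  app c := ModuleCat.ofHom (Submodule.liftQ _ (d.app c).hom (by rintro _ ⟨x, rfl⟩; exact h c x))
  naturality c c' q := by
    refine ModuleCat.hom_ext (Submodule.linearMap_qext _ (LinearMap.ext fun x => ?_))
    exact ConcreteCategory.congr_hom (d.naturality q) x

end Functors

variable {V : Type u} [Quiver.{u} V]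

/-- A morphism of representations given by linear maps compatible with the arrows. -/
def Rep.homMk {X Y : Rep V R} (h : ∀ i, X.at i →ₗ[R] Y.at i)
    (hh : ∀ {i j : V} (a : i ⟶ j) (x : X.at i), h j (X.arrow a x) = Y.arrow a (h i x)) : X ⟶ Y where
  app c := ModuleCat.ofHom (h c)
  naturality {c d} p := by
    refine ModuleCat.hom_ext (LinearMap.ext fun x => ?_)
    induction p using Paths.induction_fixed_source with
    | id => rw [X.map_id, Y.map_id]; rfl
    | comp p a ih =>
      rw [X.map_comp, Y.map_comp]
      refine (hh a ((X.map p).hom x)).trans ?_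
      exact congrArg (Y.arrow a) ih

theorem isShortExactRep_quotFunctor {X E : Rep V R} (ε : X ⟶ E)
    (hε : ∀ i, Function.Injective (Rep.homAt ε i)) : IsShortExactRep ε (quotFunctorπ ε) where
  injective := hε
  exact i := LinearMap.exact_map_mkQ_range (Rep.homAt ε i)
  surjective i := Submodule.mkQ_surjective (LinearMap.range (Rep.homAt ε i))

section Lifting

variable {X E Y : Rep V R} {ε : X ⟶ E} {π : E ⟶ Y}

/-- Lifting of maps from a finitely presented module at a vertex `i`, killed by finitely many arrows
starting at `i`. -/
theorem SystemsSolvable.exists_lift (h : SystemsSolvable ε) (hs : IsShortExactRep ε π)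
    (P : Type u) [AddCommGroup P] [Module R P] (hP : Module.FinitePresentation R P) (i : V)
    {A : Type u} [Finite A] (t : A → V) (α : ∀ a, i ⟶ t a) (g : P →ₗ[R] Y.at i)
    (hg : ∀ a x, Y.arrow (α a) (g x) = 0) :
    ∃ k : P →ₗ[R] E.at i, (∀ x, Rep.homAt π i (k x) = g x) ∧ ∀ a x, E.arrow (α a) (k x) = 0 := by
  obtain ⟨s, hspan, T, hT⟩ := hP.out
  let q : (s →₀ R) →ₗ[R] P := Finsupp.linearCombination R ((↑) : s → P)
  have hq : Function.Surjective q := by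
    rw [← LinearMap.range_eq_top, Finsupp.range_linearCombination, Subtype.range_coe]
    exact hspan
  choose e he using fun b : s => hs.surjective i (g b)
  have hLe : ∀ z, Rep.homAt π i (Finsupp.linearCombination R e z) = g (q z) := fun z => by
    have : Rep.homAt π i ∘ₗ Finsupp.linearCombination R e = g ∘ₗ q := by
      refine Finsupp.lhom_ext fun b r => ?_
      simp only [LinearMap.comp_apply, q, Finsupp.linearCombination_single, map_smul, he]
    exact LinearMap.congr_fun this z
  let v : s → Paths V := fun _ => (Paths.of V).obj i
  -- The unknowns are the generators of `P`. The equations are the relations of `P`, at `i`, and the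
  -- vanishing along each arrow `α a`, at `t a`. The lifts `e` satisfy them modulo `X`, so the
  -- defects are constants in `X`. For a solution `y` in `X` with these constants, `e - ε y`
  -- satisfies them exactly.
  let w : T ⊕ (A × s) → Paths V := Sum.elim (fun _ => (Paths.of V).obj i)
    fun p => (Paths.of V).obj (t p.1)
  let ρ : ∀ l, FreeOn R v (w l) := fun l => match l with
    | .inl z => Finsupp.mapDomain (fun b => ⟨b, 𝟙 _⟩) (z : s →₀ R)
    | .inr p => Finsupp.single ⟨p.2, (Paths.of V).map (α p.1)⟩ 1
  have hρ : ∀ (Z : Rep V R) (y : s → Z.at i) (z : T), freeEval Z v y (w (.inl z)) (ρ (.inl z)) =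
      Finsupp.linearCombination R y (z : s →₀ R) := fun Z y z => by
    refine (Finsupp.linearCombination_mapDomain R _ (z : s →₀ R)).trans ?_
    congr 2
    funext b
    exact ConcreteCategory.congr_hom (Z.map_id ((Paths.of V).obj i)) (y b)
  have hρ' : ∀ (Z : Rep V R) (y : s → Z.at i) (p : A × s),
      freeEval Z v y (w (.inr p)) (ρ (.inr p)) = Z.arrow (α p.1) (y p.2) := fun Z y p =>
    (freeEval_single Z v y p.2 _ 1).trans (one_smul R _)
  have hker : ∀ z : T, q z = 0 := fun z => by
    have : (z : s →₀ R) ∈ LinearMap.ker q := hT ▸ Submodule.subset_span z.2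
    exact this
  have hx : ∀ l, ∃ x, (ε.app (w l)).hom x = freeEval E v e (w l) (ρ l) := by
    rintro (z | p)
    · refine (hs.exact i _).1 ?_
      rw [hρ]
      refine (hLe z).trans ?_
      rw [hker, map_zero]
    · refine (hs.exact (t p.1) _).1 ?_
      rw [hρ']
      refine (Rep.homAt_arrow π _ _).trans ?_
      rw [he, hg]
  choose x hx using hx
  obtain ⟨y, hy⟩ := h.exists_of_finite v w ρ x e fun l => (hx l).symm
  let κ : (s →₀ R) →ₗ[R] E.at i := Finsupp.linearCombination R e -
    Rep.homAt ε i ∘ₗ Finsupp.linearCombination R y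
  have hκ : LinearMap.ker q ≤ LinearMap.ker κ := by
    refine hT.symm.trans_le (Submodule.span_le.2 fun z hz => ?_)
    have h1 := (hρ E e ⟨z, hz⟩).symm.trans (hx (.inl ⟨z, hz⟩)).symm
    have h2 := (hρ X y ⟨z, hz⟩).symm.trans (hy (.inl ⟨z, hz⟩))
    refine sub_eq_zero.2 (h1.trans ?_)
    exact (congrArg (Rep.homAt ε i) h2).symm
  have harrow : ∀ a z, E.arrow (α a) (κ z) = 0 := fun a z => by
    have : E.arrow (α a) ∘ₗ κ = 0 := Finsupp.lhom_ext fun b r => by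
      have h1 := (hρ' E e (a, b)).symm.trans (hx (.inr (a, b))).symm
      have h2 := (hρ' X y (a, b)).symm.trans (hy (.inr (a, b)))
      simp only [LinearMap.comp_apply, κ, LinearMap.sub_apply, Finsupp.linearCombination_single,
        map_smul, map_sub, LinearMap.zero_apply]
      rw [← smul_sub]
      refine (congrArg (r • ·) (sub_eq_zero.2 ?_)).trans (smul_zero r)
      refine h1.trans ?_
      exact (congrArg (Rep.homAt ε (t a)) h2).symm.trans (Rep.homAt_arrow ε _ _)
    exact LinearMap.congr_fun this z
  let k : P →ₗ[R] E.at i := (LinearMap.ker q).liftQ κ hκ ∘ₗ (q.quotKerEquivOfSurjective hq).symm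
  have hk : ∀ z, k (q z) = κ z := fun z => by
    have : (q.quotKerEquivOfSurjective hq).symm (q z) = Submodule.Quotient.mk z := by
      rw [LinearEquiv.symm_apply_eq]
      rfl
    exact congrArg ((LinearMap.ker q).liftQ κ hκ) this
  refine ⟨k, fun x => ?_, fun a x => ?_⟩ <;> obtain ⟨z, rfl⟩ := hq x <;> rw [hk]
  · rw [LinearMap.sub_apply, map_sub, hLe]
    refine (congrArg (g (q z) - ·) ?_).trans (sub_zero _)
    exact (hs.exact i).apply_apply_eq_zero _
  · exact harrow a z

theorem SystemsSolvable.fpLifting (h : SystemsSolvable ε) (hs : IsShortExactRep ε π) (i : V) :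
    FpLifting (Rep.homAt π i) := fun P _ _ hP g => by
  obtain ⟨k, hk, -⟩ := h.exists_lift hs P hP i PEmpty.elim (fun a => a.elim) g (fun a => a.elim)
  exact ⟨k, LinearMap.ext hk⟩

/-- As `ψ` of `E` splits, the target data lift to `g : P → E(i)`. The image of `g` in `Y` is killed
by all outgoing arrows, hence lifts to some `k` also killed by them. Then `g - k` lands in `X(i)`
and has the same coordinates as `g`. -/
theorem SystemsSolvable.fpLifting_psi (hfin : LocallyTargetFinite V) [Injective E]
    (h : SystemsSolvable ε) (hs : IsShortExactRep ε π) (i : V) : FpLifting (Rep.psi X i) := by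
  intro P _ _ hP f
  have := hfin i
  obtain ⟨g, hg⟩ := fpLifting_psi_of_injective E i P hP
    (LinearMap.pi fun a => Rep.homAt ε a.1 ∘ₗ LinearMap.proj a ∘ₗ f)
  have hg : ∀ (a : Quiver.Star i) x, E.arrow a.2 (g x) = Rep.homAt ε a.1 (f x a) := fun a x =>
    congrFun (LinearMap.congr_fun hg x) a
  obtain ⟨k, hk, hk'⟩ := h.exists_lift hs P hP i (fun a : Quiver.Star i => a.1) (fun a => a.2)
    (Rep.homAt π i ∘ₗ g) fun a x => by
      refine (Rep.homAt_arrow π _ _).symm.trans ?_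
      rw [hg]
      exact (hs.exact _).apply_apply_eq_zero _
  obtain ⟨l, hl⟩ := exists_comp_eq_of_exact (hs.injective i) (hs.exact i) (g - k) fun x => by
    rw [LinearMap.sub_apply, map_sub, hk]
    exact sub_self _
  refine ⟨l, LinearMap.ext fun x => funext fun a => hs.injective a.1 ?_⟩
  refine (Rep.homAt_arrow ε a.2 (l x)).trans ?_
  rw [hl, LinearMap.sub_apply, map_sub, hk', sub_zero, hg]

/-- Solvability of systems when maps from objectwise finitely presented representations lift. -/
theorem SystemsSolvable.of_vertexwise (hfin : LocallyTargetFinite V)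
    (hwf : WellFounded fun j i : V => Nonempty (i ⟶ j)) (hs : IsShortExactRep ε π)
    (hX : ∀ i, FpLifting (Rep.homAt π i)) (hψ : ∀ i, FpLifting (Rep.psi X i)) :
    SystemsSolvable ε := by
  have : ∀ c d : Paths V, Finite (c ⟶ d) := fun c d => hfin.finite_path hwf c d
  refine SystemsSolvable.of_lifting (Y := Y) (π := π) hs.injective hs.exact
    fun (F : Rep V R) hF f => ?_
  let Lift : V → Type u := fun i => {g : F.at i →ₗ[R] E.at i // Rep.homAt π i ∘ₗ g = Rep.homAt f i}
  have step : ∀ (i : V) (g : ∀ j, Nonempty (i ⟶ j) → Lift j), ∃ k : Lift i,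
      ∀ (j : V) (a : i ⟶ j) (x : F.at i), (g j ⟨a⟩).1 (F.arrow a x) = E.arrow a (k.1 x) := by
    intro i g
    obtain ⟨k₀, hk₀⟩ := hX i _ (hF ((Paths.of V).obj i)) (Rep.homAt f i)
    -- The failure of `k₀` to commute with `a` vanishes in `Y`, so it is a map `l` into `X(t(a))`.
    -- Lifting all these maps at once along `ψ` of `X` gives the correction to `k₀`.
    have hδ : ∀ a : Quiver.Star i, ∃ l : F.at i →ₗ[R] X.at a.1, ∀ x, Rep.homAt ε a.1 (l x) =
        ((g a.1 ⟨a.2⟩).1 ∘ₗ F.arrow a.2 - E.arrow a.2 ∘ₗ k₀) x := fun a => by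
      refine exists_comp_eq_of_exact (hs.injective _) (hs.exact _) _ fun x => ?_
      rw [LinearMap.sub_apply, map_sub, sub_eq_zero]
      refine (LinearMap.congr_fun (g a.1 ⟨a.2⟩).2 _).trans ?_
      refine (Rep.homAt_arrow f _ _).trans ?_
      refine Eq.trans ?_ (Rep.homAt_arrow π _ _).symm
      exact congrArg (Y.arrow a.2) (LinearMap.congr_fun hk₀ x).symm
    choose l hl using hδ
    obtain ⟨k, hk⟩ := hψ i _ (hF ((Paths.of V).obj i)) (LinearMap.pi l)
    refine ⟨⟨k₀ + Rep.homAt ε i ∘ₗ k, ?_⟩, fun j a x => ?_⟩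
    · refine LinearMap.ext fun x => ?_
      rw [LinearMap.comp_apply, LinearMap.add_apply, map_add]
      refine Eq.trans ?_ (LinearMap.congr_fun hk₀ x)
      refine (congrArg (_ + ·) ?_).trans (add_zero _)
      exact (hs.exact i).apply_apply_eq_zero _
    · rw [LinearMap.add_apply, map_add]
      have h1 := hl ⟨j, a⟩ x
      have h2 : X.arrow a (k x) = l ⟨j, a⟩ x := congrFun (LinearMap.congr_fun hk x) ⟨j, a⟩
      rw [← h2, Rep.homAt_arrow, LinearMap.sub_apply] at h1
      rw [LinearMap.comp_apply, h1]
      exact (add_sub_cancel _ _).symm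
  -- The lift at `i` is built from those at the targets of its arrows, so compatibility with every
  -- arrow follows by unfolding the recursion once.
  let g : ∀ i, Lift i := hwf.fix fun i g => (step i g).choose
  have hg : ∀ {i j : V} (a : i ⟶ j) (x : F.at i),
      (g j).1 (F.arrow a x) = E.arrow a ((g i).1 x) := by
    intro i j a x
    have := (step i fun j _ => g j).choose_spec j a x
    have h2 : g i = (step i fun j _ => g j).choose := hwf.fix_eq _ i
    rw [h2]
    exact this
  refine ⟨Rep.homMk (fun i => (g i).1) hg, ?_⟩
  ext c : 2
  exact ModuleCat.hom_ext (g c).2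

end Lifting

/-- Pure epimorphisms are the maps along which maps from finitely presented modules lift. -/
theorem isPureEpi_iff {M N : Type u} [AddCommGroup M] [Module R M] [AddCommGroup N] [Module R N]
    (g : M →ₗ[R] N) : IsPureEpi g ↔ FpLifting g := by
  unfold IsPureEpi
  rw [isPureShortExact_iff]
  constructor
  · rintro ⟨hs, h⟩
    exact (SystemsSolvable.of_tensor_injective (h _)).fpLifting (isShortExactRep_constHom hs) pt
  · intro h
    have hs : IsShortExact (LinearMap.ker g).subtype.toAddMonoidHom g.toAddMonoidHom :=
      ⟨Subtype.val_injective, LinearMap.exact_subtype_ker_map g, h.surjective⟩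
    have hs' := isShortExactRep_constHom hs
    refine ⟨hs, fun S => SystemsSolvable.tensor_injective (V := Point.{u}) ?_ hs'.injective S⟩
    have hfin : LocallyTargetFinite Point.{u} := fun i =>
      have : IsEmpty (Quiver.Star i) := ⟨fun a => PEmpty.elim a.2⟩
      Finite.of_subsingleton
    have hwf : WellFounded fun j i : Point.{u} => Nonempty (i ⟶ j) :=
      ⟨fun i => ⟨i, fun _ ha => ha.elim fun a => PEmpty.elim a⟩⟩
    refine SystemsSolvable.of_vertexwise hfin hwf hs' (fun _ => h) fun i P _ _ _ f => ?_
    -- Without arrows the target of `ψ` is an empty product, so any map is a lift.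
    exact ⟨0, LinearMap.ext fun x => funext fun a => PEmpty.elim a.2⟩

end Reps

section AddMonoidHom

variable {A B C D : Type*} [AddCommGroup A] [AddCommGroup B] [AddCommGroup C] [AddCommGroup D]

theorem exact_injective_comp_iff {f : A →+ B} {g : B →+ C} {k : C →+ D}
    (hk : Function.Injective k) : Function.Exact f (k.comp g) ↔ Function.Exact f g :=
  forall_congr' fun _ => by rw [AddMonoidHom.comp_apply, map_eq_zero_iff k hk]

theorem exact_comp_surjective_iff {f : A →+ B} {g : B →+ C} {k : C →+ D}
    (hf : Function.Surjective f) : Function.Exact (g.comp f) k ↔ Function.Exact g k :=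
  forall_congr' fun _ => by rw [AddMonoidHom.coe_comp, hf.range_comp]

end AddMonoidHom

/-! ### Resolutions and dimension shifting -/

section Resolutions

variable {V : Type u} [Quiver.{u} V] {R : Type u} [Ring R]

/-- The first step of a pure acyclic injective resolution. -/
theorem StronglyFpInjective.exists_step {X : Rep V R} (h : StronglyFpInjective X) :
    ∃ (E Y : Rep V R) (ε : X ⟶ E) (π : E ⟶ Y), Injective E ∧ IsShortExactRep ε π ∧
      SystemsSolvable ε ∧ StronglyFpInjective Y := by
  obtain ⟨E, ε, d, hE, hex, hten⟩ := h
  have hs := isShortExactRep_quotFunctor ε fun i => (hex i).1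
  -- The differential `d 0` factors through the cokernel of `ε`. Exactness at `E 0`, before and
  -- after tensoring, becomes injectivity of `ε'`, so the shifted sequence resolves the cokernel.
  let ε' : quotFunctor ε ⟶ E 1 := quotFunctorDesc ε (d 0) fun c =>
    (hex c).2.1.apply_apply_eq_zero
  have hπ : quotFunctorπ ε ≫ ε' = d 0 := rfl
  refine ⟨E 0, quotFunctor ε, ε, quotFunctorπ ε, hE 0, hs,
    .of_tensor_injective (hten _).1, fun n => E (n + 1), ε', fun n => d (n + 1),
    fun n => hE _, fun i => ⟨?_, ?_, fun n => (hex i).2.2 (n + 1)⟩,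
    fun S => ⟨?_, ?_, fun n => (hten S).2.2 (n + 1)⟩⟩
  · rw [injective_iff_map_eq_zero]
    intro y hy
    obtain ⟨e, rfl⟩ := hs.surjective i y
    exact (hs.exact i _).2 (((hex i).2.1 e).1 hy)
  · have h0 := (hex i).2.2 0
    exact (hs.surjective i).comp_exact_iff_exact.1 h0
  · have h0 := (hten S).2.1
    rw [← hπ, Tensor.map_comp] at h0
    rw [injective_iff_map_eq_zero]
    intro y hy
    obtain ⟨e, rfl⟩ := hs.tensor_surjective S y
    exact (hs.tensor_exact S _).2 ((h0 e).1 hy)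
  · have h0 := (hten S).2.2 0
    rw [← hπ, Tensor.map_comp] at h0
    exact (exact_comp_surjective_iff (hs.tensor_surjective S)).1 h0

/-- The induction on the degree generalizes over `X`: degree `n + 2` for `X` reduces to degree `n +
1` for the cokernel, again strongly fp-injective. Degree one uses lifting along the pure
epimorphism. -/
theorem StronglyFpInjective.at_vertex {X : Rep V R} (h : StronglyFpInjective X) (i : V) :
    StronglyFpInjectiveModule (X.at i) := by
  intro N hN n hn
  obtain ⟨n, rfl⟩ : ∃ m, n = m + 1 := ⟨n - 1, by omega⟩
  clear hn
  induction n generalizing X with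
  | zero =>
    obtain ⟨E, Y, ε, π, hE, hs, hsys, -⟩ := h.exists_step
    exact subsingleton_ext_succ_left N 0
      (stronglyFpInjectiveModule_at_of_injective E i N hN 1 le_rfl) (fun h => absurd h (by omega))
      hN (hs.injective i) (hs.exact i) (hsys.fpLifting hs i)
  | succ n ih =>
    obtain ⟨E, Y, ε, π, hE, hs, hsys, hY⟩ := h.exists_step
    exact subsingleton_ext_succ_left N (n + 1)
      (stronglyFpInjectiveModule_at_of_injective E i N hN _ (by omega)) (fun _ => ih hY)
      hN (hs.injective i) (hs.exact i) (hsys.fpLifting hs i)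

/-- The vertexwise condition characterizing strongly fp-injective representations. -/
def VertexCondition (X : Rep V R) : Prop :=
  ∀ i : V, StronglyFpInjectiveModule (X.at i) ∧ FpLifting (Rep.psi X i)

theorem VertexCondition.fpLifting {X E Y : Rep V R} {ε : X ⟶ E} {π : E ⟶ Y}
    (h : VertexCondition X) (hs : IsShortExactRep ε π) (i : V) : FpLifting (Rep.homAt π i) :=
  StronglyFpInjectiveModule.fpLifting (h i).1 (hs.injective i) (hs.exact i) (hs.surjective i)

/-- For `ψ` of `Y`, lift each coordinate to `E`, lift the resulting family along `ψ` of `E`, and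
project back to `Y`. -/
theorem VertexCondition.of_isShortExactRep {X E Y : Rep V R} {ε : X ⟶ E} {π : E ⟶ Y}
    (h : VertexCondition X) (hs : IsShortExactRep ε π) [Injective E] : VertexCondition Y := by
  refine fun i => ⟨StronglyFpInjectiveModule.of_left_middle (h i).1
    (stronglyFpInjectiveModule_at_of_injective E i) (hs.injective i) (hs.exact i)
    (hs.surjective i), fun P _ _ hP f => ?_⟩
  choose e he using fun a : Quiver.Star i => h.fpLifting hs a.1 P hP (LinearMap.proj a ∘ₗ f)
  obtain ⟨g, hg⟩ := fpLifting_psi_of_injective E i P hP (LinearMap.pi e)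
  refine ⟨Rep.homAt π i ∘ₗ g, LinearMap.ext fun x => funext fun a => ?_⟩
  refine (Rep.homAt_arrow π a.2 (g x)).symm.trans ?_
  have h1 : E.arrow a.2 (g x) = e a x := congrFun (LinearMap.congr_fun hg x) a
  rw [h1]
  exact LinearMap.congr_fun (he a) x

/-- The cosyzygies of the resolution by coinduced representations. -/
noncomputable def cosyzygy (X : Rep V R) : ℕ → Rep V R
  | 0 => X
  | n + 1 => quotFunctor (injectiveHullι (cosyzygy X n))

theorem isShortExactRep_cosyzygy (X : Rep V R) (n : ℕ) :
    IsShortExactRep (Y := cosyzygy X (n + 1)) (injectiveHullι (cosyzygy X n)) (quotFunctorπ _) :=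
  isShortExactRep_quotFunctor _ fun i =>
    injectiveHullι_app_injective (cosyzygy X n) ((Paths.of V).obj i)

theorem VertexCondition.cosyzygy {X : Rep V R} (h : VertexCondition X) (n : ℕ) :
    VertexCondition (cosyzygy X n) := by
  induction n with
  | zero => exact h
  | succ n ih =>
    have : Injective (injectiveHull (QuiverRep.cosyzygy X n)) := injective_coinduced _
    exact ih.of_isShortExactRep (isShortExactRep_cosyzygy X n)

/-- Each short exact sequence of cosyzygies is pure, so splicing them gives a sequence that stays
exact under every `S ⊗ -`. -/
theorem VertexCondition.stronglyFpInjective {X : Rep V R} (h : VertexCondition X)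
    (hfin : LocallyTargetFinite V) (hwf : WellFounded fun j i : V => Nonempty (i ⟶ j)) :
    StronglyFpInjective X := by
  let Z := QuiverRep.cosyzygy X
  let ε : ∀ n, Z n ⟶ injectiveHull (Z n) := fun n => injectiveHullι (Z n)
  let π : ∀ n, injectiveHull (Z n) ⟶ Z (n + 1) := fun n => quotFunctorπ (ε n)
  have hs : ∀ n, IsShortExactRep (ε n) (π n) := isShortExactRep_cosyzygy X
  have hinj : ∀ n (S : Rep Vᵒᵖ Rᵐᵒᵖ), Function.Injective (Tensor.map S (ε n)) := fun n S =>
    (SystemsSolvable.of_vertexwise hfin hwf (hs n) ((h.cosyzygy n).fpLifting (hs n))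
      fun i => (h.cosyzygy n i).2).tensor_injective (hs n).injective S
  refine ⟨fun n => injectiveHull (Z n), ε 0, fun n => π n ≫ ε (n + 1),
    fun n => injective_coinduced _, fun i => ⟨(hs 0).injective i, ?_, fun n => ?_⟩,
    fun S => ⟨hinj 0 S, ?_, fun n => ?_⟩⟩
  · exact ((hs 1).injective i).comp_exact_iff_exact.2 ((hs 0).exact i)
  · have h1 := ((hs (n + 2)).injective i).comp_exact_iff_exact.2 ((hs (n + 1)).exact i)
    exact ((hs n).surjective i).comp_exact_iff_exact.2 h1
  · rw [Tensor.map_comp]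
    exact (exact_injective_comp_iff (hinj 1 S)).2 ((hs 0).tensor_exact S)
  · rw [Tensor.map_comp, Tensor.map_comp]
    have h1 := (exact_injective_comp_iff (hinj (n + 2) S)).2 ((hs (n + 1)).tensor_exact S)
    exact (exact_comp_surjective_iff ((hs n).tensor_surjective S)).2 h1

end Resolutions

end QuiverRep

theorem theorem3p10 {V : Type u} [Quiver.{u} V] {R : Type u} [Ring R]
    (hfin : QuiverRep.LocallyTargetFinite V) (hroot : QuiverRep.RightRooted V)
    (X : QuiverRep.Rep V R) :
    QuiverRep.StronglyFpInjective X ↔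
      ∀ i : V, QuiverRep.StronglyFpInjectiveModule (X.at i) ∧
        QuiverRep.IsPureEpi (QuiverRep.Rep.psi X i) := by
  simp only [QuiverRep.isPureEpi_iff]
  constructor
  · intro h i
    obtain ⟨E, Y, ε, π, hE, hs, hsys, -⟩ := h.exists_step
    exact ⟨h.at_vertex i, hsys.fpLifting_psi hfin hs i⟩
  · intro h
    exact QuiverRep.VertexCondition.stronglyFpInjective h hfin hroot.wellFounded
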